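/- **Programs.** Fix threads, addresses $\mathit{Adr}$, data values, pointer variables (some of them shared), data variables and angels (both thread-local), and SMR functions, one of which is $\mathtt{retire}$, taking a single pointer. Statements are built from $\mathtt{skip}$ and commands by sequence $s_1;s_2$, choice $s_1\oplus s_2$ and iteration $s^*$. Commands are $p:=q$, $p:=q.\mathtt{next}$, $p.\mathtt{next}:=q$, $u:=q.\mathtt{data}$, $p.\mathtt{data}:=u$, $u:=op(\vec u)$, $p:=\mathtt{malloc}$, $\mathtt{assume}\ c$ with $c$ one of $p=q$, $p\neq q$, $\mathit{pred}(\vec u)$, $\mathtt{beginAtomic}$, $\mathtt{endAtomic}$, $\mathtt{enter}\,f(\vec p,\vec u)$, $\mathtt{exit}\,f$, and the annotations $@\mathtt{inv}\ i$ with $i$ one of $\mathtt{angel}\,r$, $p=q$, $p\ \mathtt{in}\ r$, $\mathtt{active}(p)$, $\mathtt{active}(r)$. Every thread executes the same program $P$ on the shared pointers and its own copies of all other variables. **Semantics.** A memory is a partial map from the variables and selectors $a.\mathtt{next},a.\mathtt{data}$ to values; initially pointer variables are $\mathtt{seg}$ (uninitialized), data variables have a default value, and selectors are undefined. A computation is a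 finite sequence of actions $(t,com,up)$ (thread $t$ executes $com$ with memory update $up$) and $(\bot,\mathtt{free}(a),\emptyset)$. While a thread is inside an atomic block only it moves; otherwise threads only take silent control steps or enter an atomic block, and the environment may free. An address is *fresh* if never allocated or freed, *freed* if freed and not reallocated since, *retired* if passed to $\mathtt{retire}$ and not freed since, and *active* if neither freed nor retired. $[\![P]\!]_X^Y$ is the set of computations that respect control flow and memory, in which only addresses in $X$ are freed, $\mathtt{malloc}$ returns a fresh address or a freed one in $Y$, and pointer arguments of $\mathtt{enter}$ differ from $\mathtt{seg}$. The *garbage-collected semantics* is $[\![P]\!]_\emptyset^\emptyset$. The annotations *hold* in $\tau$ if one can choose a set of addresses at every execution of $\mathtt{angel}\,r$ in $\tau$ (as the new content of $r$; angels are initially empty) such that every annotation executed in $\tau$ is true when executed: $p=q$ as values, $p$ holds an address in $r$, $p$ holds an active address, all addresses in $r$ are active. An address is *possibly held* by $r$ after $\tau$ if it is in $r$ under some such choice. *Valid* pointer expressions: initially all pointer variables. Copying, loading or storing a pointer makes the target valid iff the source is; $p:=\mathtt{malloc}$ returning $a$ makes $p$ and $a.\mathtt{next}$ valid; $\mathtt{assume}\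 p=q$ makes both valid if one is; $\mathtt{free}(a)$ makes $a.\mathtt{next}$ and all pointer expressions with value $a$ invalid; nothing else changes validity. **SMR automata.** The *history* of $\tau$ is its sequence of events $f(t,\vec a,\vec d)$ (from $\mathtt{enter}$), $\mathtt{exit}\,f(t)$, $\mathtt{free}(a)$. An SMR automaton $O$ has locations, an initial one, accepting ones, variables storing threads or addresses, among them $z_t$ and $z_a$, and transitions labelled by event types and guarded by Boolean combinations of equalities over variables, event parameters and data constants. A state is $(l,\varphi)$ with $\varphi$ a valuation, which is fixed along a run. $\mathit{Spec}(O)$ is the set of histories that lead from no initial state $(l_{init},\varphi)$ to an accepting location. Let $O=O_{Base}\times O'$ for some SMR automaton $O'$, accepting if one of the factors accepts, where $O_{Base}$ has the initial location $\mathit{init}$, a location $\mathit{retired}$ and the accepting location $\mathit{final}$, and goes from $\mathit{init}$ to $\mathit{retired}$ on $\mathtt{retire}(t,a)$ with $a=z_a$, from $\mathit{retired}$ to $\mathit{init}$ on $\mathtt{free}(a)$ with $a=z_a$, from $\mathit{init}$ to $\mathit{final}$ on $\mathtt{free}(a)$ with $a=z_a$, and loops otherwise. Assume that $O$ has a step for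 every event in every state, that its initial location is not accepting, that accepting locations are entered only by $\mathtt{free}$ events, and that they are never left. The *SMR semantics without reallocation* is $O[\![P]\!]=\{\tau\in[\![P]\!]_{\mathit{Adr}}^{\emptyset} : \text{the history of }\tau\text{ is in }\mathit{Spec}(O)\}$. **Types.** A set $L$ of locations of $O$ is *closed under interference* if no step $(l,\varphi)\to(l',\varphi)$ with $l\in L$ under an event not executed by thread $\varphi(z_t)$ (frees are executed by no thread) has $l'\notin L$. Guarantees are $\mathbb L,\mathbb A,\mathbb S$, and $\mathbb E_L$ for $L$ closed under interference; a type is a set of guarantees. Put $\mathit{Loc}(\mathbb L)=\mathit{Loc}(\mathbb A)=\{\mathit{init}\}\times \mathit{Loc}_{O'}$, where $\mathit{Loc}_{O'}$ is the set of locations of $O'$; $\mathit{Loc}(\mathbb S)$ is the largest set that is closed under interference and from which $\mathtt{free}(\varphi(z_a))$ leads to accepting locations only; $\mathit{Loc}(\mathbb E_L)=L$; and $\mathit{Loc}(T)=\bigcap_{g\in T}\mathit{Loc}(g)$, which is the set of all locations for $T=\emptyset$. $\mathit{isValid}(T)$ means $T\cap\{\mathbb L,\mathbb A,\mathbb S\}\neq\emptyset$.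 An environment $\Gamma$ maps pointers and angels to types; $\Gamma_{init}\equiv\emptyset$. Write $\Gamma,com\rightsquigarrow\Gamma'$ if for every $x$: $\mathit{post}_{x,com}(\mathit{Loc}(\Gamma(x)))\subseteq\mathit{Loc}(\Gamma'(x))$, $\mathit{isValid}(\Gamma'(x))\Rightarrow\mathit{isValid}(\Gamma(x))$, and $\{\mathbb L,\mathbb A\}\cap\Gamma'(x)\subseteq\{\mathbb L,\mathbb A\}\cap\Gamma(x)$. Here $\mathit{post}_{x,com}(L)$ contains the targets of steps from $L$ under events that $com$ can emit when executed by some thread $\varphi(z_t)$, with $x$ holding $\varphi(z_a)$ if $x$ is a pointer. Write $\Gamma\rightsquigarrow\Gamma'$ for the same with $\mathit{post}$ the identity. $\mathit{SafeCall}(\Gamma,f(\vec p,\vec u))$ means: for all $h,t,\vec a,\vec b,c,\vec d$ such that $a_i=b_i$ whenever $a_i=c$ or $\mathit{isValid}(\Gamma(p_i))$, we have $\mathcal F(h.f(t,\vec b,\vec d),c)\subseteq\mathcal F(h.f(t,\vec a,\vec d),c)$, where $\mathcal F(h,c)=\{h' : h.h'\in\mathit{Spec}(O),\ h'\text{ frees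 at most }c\}$. Derivations $\vdash\{\Gamma\}\,s\,\{\Gamma'\}$ are generated by the following rules, where $\Gamma[x:T]$ denotes update (applied from left to right) and unmentioned types are unchanged. - $p:=q$ : $\Gamma'=\Gamma[p:T][q:T]$ with $T=\Gamma(q)\setminus\{\mathbb L\}$. - $p:=q.\mathtt{next}$, if $\mathit{isValid}(\Gamma(q))$ : $\Gamma[p:\emptyset]$. - $p.\mathtt{next}:=q$, if $\mathit{isValid}(\Gamma(p))$ : $\Gamma[q:\Gamma(q)\setminus\{\mathbb L\}]$. - $u:=op(\vec u)$; and $u:=q.\mathtt{data}$, $q.\mathtt{data}:=u$ if $\mathit{isValid}(\Gamma(q))$ : $\Gamma$. - $p:=\mathtt{malloc}$ with $p$ not shared : $\Gamma[p:\{\mathbb L\}]$. - $\mathtt{assume}\ p=q$, if both types are valid : $\Gamma[p:T][q:T]$ with $T=(\Gamma(p)\cup\Gamma(q))\setminus\{\mathbb L\}$. Other $\mathtt{assume}$ : $\Gamma$. - $@\mathtt{inv}\ p=q$ : $\Gamma[p:T][q:T]$ with $T=\Gamma(p)\cup\Gamma(q)$. $@\mathtt{inv}\ \mathtt{active}(x)$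 : $\Gamma[x:\Gamma(x)\cup\{\mathbb A\}]$. $@\mathtt{inv}\ \mathtt{angel}\,r$ : $\Gamma[r:\emptyset]$. $@\mathtt{inv}\ p\ \mathtt{in}\ r$ : $\Gamma[p:\Gamma(p)\cup\Gamma(r)]$. - $\mathtt{enter}\,f(\vec p,\vec u)$ : any $\Gamma'$ with $\Gamma,\mathtt{enter}\,f(\vec p,\vec u)\rightsquigarrow\Gamma'$, if $\mathit{SafeCall}(\Gamma,f(\vec p,\vec u))$ and, in case $f=\mathtt{retire}$, $\mathbb A\in\Gamma(p_1)$. $\mathtt{exit}\,f$ : any $\Gamma'$ with $\Gamma,\mathtt{exit}\,f\rightsquigarrow\Gamma'$. - $\mathtt{skip}$, $\mathtt{beginAtomic}$ : $\Gamma$. $\mathtt{endAtomic}$ : shared pointers get type $\emptyset$, and $\mathbb A$ is removed from all other types. - The usual rules for sequence, choice (same pre- and post-environment in both branches) and iteration ($\Gamma$ is invariant), and the consequence rule: from $\Gamma_1\rightsquigarrow\Gamma_2$, $\vdash\{\Gamma_2\}s\{\Gamma_3\}$, $\Gamma_3\rightsquigarrow\Gamma_4$ infer $\vdash\{\Gamma_1\}s\{\Gamma_4\}$.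 **Theorem (Soundness).** Suppose the annotations hold in every computation in $[\![P]\!]_\emptyset^\emptyset$, and $\vdash\{\Gamma_{init}\}\,P\,\{\Gamma\}$ is derivable. Let $\tau\in O[\![P]\!]$ and let $t$ be a thread that can have executed $P$ to completion after $\tau$. Then: 1. for every pointer or angel $x$, every address $a$ that is held by $t$'s instance of $x$ after $\tau$ (possibly held, if $x$ is an angel), and every valuation $\varphi$ with $\varphi(z_t)=t$ and $\varphi(z_a)=a$, the history of $\tau$ leads from $(l_{init},\varphi)$ to some location in $\mathit{Loc}(\Gamma(x))$ and to no location outside $\mathit{Loc}(\Gamma(x))$; 2. for every pointer $p$ whose type $\Gamma(p)$ contains one of $\mathbb L,\mathbb A,\mathbb S$, $t$'s instance of $p$ is valid after $\tau$. -/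

import Mathlib

namespace SMR

/-! ## Programs -/

/-- The parameters of the programming language: threads, addresses, data values, the three kinds of
program variables, and the functions offered by the SMR algorithm. A function `f` takes `nPtr f`
pointer and `nDat f` data arguments; `retire` takes one pointer. Only pointer variables can be
shared; data variables and angels are thread-local. -/
structure Sig where
  Thread : Type
  Adr : Type
  Dom : Type
  PVar : Type
  DVar : Type
  AVar : Type
  Fn : Type
  /-- the default value of data variables -/
  dflt : Dom
  shared : Set PVar
  nPtr : Fn → ℕ
  nDat : Fn → ℕ
  retire : Fn
  nPtr_retire : nPtr retire = 1
  nDat_retire : nDat retire = 0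

/-- Conditions `p = q`, `p ≠ q`, `pred(u₁,…,uₙ)`. Predicates are given by their interpretation. -/
inductive Cond (S : Sig) : Type
  | eq (p q : S.PVar)
  | ne (p q : S.PVar)
  | pred (n : ℕ) (R : (Fin n → S.Dom) → Prop) (us : Fin n → S.DVar)

/-- Invariant annotations: `angel r`, `p = q`, `p in r`, `active(p)`, `active(r)`. -/
inductive Inv (S : Sig) : Type
  | angel (r : S.AVar)
  | eq (p q : S.PVar)
  | mem (p : S.PVar) (r : S.AVar)
  | activePtr (p : S.PVar)
  | activeAngel (r : S.AVar)

/-- Primitive commands. Operations on data are given by their interpretation. -/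
inductive Com (S : Sig) : Type
  /-- `p := q` -/
  | assign (p q : S.PVar)
  /-- `p := q.next` -/
  | load (p q : S.PVar)
  /-- `p.next := q` -/
  | store (p q : S.PVar)
  /-- `u := q.data` -/
  | loadData (u : S.DVar) (q : S.PVar)
  /-- `p.data := u` -/
  | storeData (p : S.PVar) (u : S.DVar)
  /-- `u := op(u₁,…,uₙ)` -/
  | op (u : S.DVar) (n : ℕ) (F : (Fin n → S.Dom) → S.Dom) (us : Fin n → S.DVar)
  | malloc (p : S.PVar)
  | assume (c : Cond S)
  | beginAtomic
  | endAtomic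
  | enter (f : S.Fn) (ps : Fin (S.nPtr f) → S.PVar) (us : Fin (S.nDat f) → S.DVar)
  | exit (f : S.Fn)
  | inv (i : Inv S)

/-- Statements; `skip` is the command without effect, it also marks completed execution. -/
inductive Stmt (S : Sig) : Type
  | skip
  | com (c : Com S)
  | seq (s₁ s₂ : Stmt S)
  | choice (s₁ s₂ : Stmt S)
  | loop (s : Stmt S)

/-! ## Memory and computations -/

/-- Values of pointer expressions; `seg` is the value of uninitialized pointers. -/
inductive PVal (S : Sig) : Type
  | seg
  | adr (a : S.Adr)

/-- Pointer expressions: instances of pointer variables and pointer selectors `a.next`.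
The instance `(p, none)` is the shared variable `p`, and `(p, some t)` is `t`'s copy of `p`. -/
inductive PExp (S : Sig) : Type
  | var (x : S.PVar × Option S.Thread)
  | sel (a : S.Adr)

/-- Data expressions: data variables (one copy per thread) and data selectors `a.data`. -/
inductive DExp (S : Sig) : Type
  | var (t : S.Thread) (u : S.DVar)
  | sel (a : S.Adr)

variable {S : Sig}

open Classical in
/-- The pointer expression that thread `t` accesses when using variable `p`. -/
noncomputable def ptrOf (t : S.Thread) (p : S.PVar) : PExp S :=
  if p ∈ S.shared then .var (p, none) else .var (p, some t)

/-- Memories are partial functions that respect the typing. -/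
structure Mem (S : Sig) : Type where
  ptr : PExp S → Option (PVal S)
  dat : DExp S → Option S.Dom

/-- A single memory update `e ↦ v`. -/
inductive Upd (S : Sig) : Type
  | ptr (e : PExp S) (v : PVal S)
  | dat (e : DExp S) (d : S.Dom)

open Classical in
noncomputable def Mem.apply (m : Mem S) : Upd S → Mem S
  | .ptr e v => { m with ptr := Function.update m.ptr e (some v) }
  | .dat e d => { m with dat := Function.update m.dat e (some d) }

def Mem.initial (S : Sig) : Mem S where
  ptr e := match e with
    | .var _ => some .seg
    | .sel _ => none
  dat e := match e with
    | .var _ _ => some S.dflt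
    | .sel _ => none

/-- Actions: `(t, com, up)` for a thread `t`, and `(⊥, free(a), ∅)`. -/
inductive Act (S : Sig) : Type
  | run (t : S.Thread) (c : Com S) (up : List (Upd S))
  | free (a : S.Adr)

/-- Computations are finite sequences of actions; `snoc τ act` is `τ.act`. -/
inductive Comp (S : Sig) : Type
  | nil
  | snoc (τ : Comp S) (act : Act S)

/-- The memory after a computation. -/
noncomputable def Comp.mem : Comp S → Mem S
  | .nil => Mem.initial S
  | .snoc τ (.run _ _ up) => up.foldl Mem.apply τ.mem
  | .snoc τ (.free _) => τ.mem

/-- Addresses that have never been allocated or freed. -/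
def Comp.fresh : Comp S → Set S.Adr
  | .nil => Set.univ
  | .snoc τ (.free a) => τ.fresh \ {a}
  | .snoc τ (.run t c up) => match c with
    | .malloc p => τ.fresh \ {a | (τ.snoc (.run t c up)).mem.ptr (ptrOf t p) = some (.adr a)}
    | _ => τ.fresh

/-- Addresses that have been freed since their last allocation. -/
def Comp.freed : Comp S → Set S.Adr
  | .nil => ∅
  | .snoc τ (.free a) => τ.freed ∪ {a}
  | .snoc τ (.run t c up) => match c with
    | .malloc p => τ.freed \ {a | (τ.snoc (.run t c up)).mem.ptr (ptrOf t p) = some (.adr a)}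
    | _ => τ.freed

open Classical in
/-- Addresses that have been retired and not freed since. -/
noncomputable def Comp.retired : Comp S → Set S.Adr
  | .nil => ∅
  | .snoc τ (.free a) => τ.retired \ {a}
  | .snoc τ (.run t c _) => match c with
    | .enter f ps _ =>
        if f = S.retire then τ.retired ∪ {a | ∃ i, τ.mem.ptr (ptrOf t (ps i)) = some (.adr a)}
        else τ.retired
    | _ => τ.retired

/-- Addresses that are neither freed nor retired. -/
def Comp.active (τ : Comp S) : Set S.Adr := (τ.freed ∪ τ.retired)ᶜ

open Classical in
/-- The valid pointer expressions after a computation. -/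
noncomputable def Comp.valid : Comp S → Set (PExp S)
  | .nil => {e | ∃ x, e = .var x}
  | .snoc τ (.free a) => τ.valid \ ({e | τ.mem.ptr e = some (.adr a)} ∪ {.sel a})
  | .snoc τ (.run t c up) => match c with
    | .assign p q =>
        if ptrOf t q ∈ τ.valid then τ.valid ∪ {ptrOf t p} else τ.valid \ {ptrOf t p}
    | .store p q => match τ.mem.ptr (ptrOf t p) with
      | some (.adr a) => if ptrOf t q ∈ τ.valid then τ.valid ∪ {.sel a} else τ.valid \ {.sel a}
      | _ => τ.valid
    | .load p q => match τ.mem.ptr (ptrOf t q) with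
      | some (.adr a) =>
          if .sel a ∈ τ.valid then τ.valid ∪ {ptrOf t p} else τ.valid \ {ptrOf t p}
      | _ => τ.valid
    | .malloc p => τ.valid ∪ {ptrOf t p} ∪ {e | ∃ a, e = .sel a ∧ .ptr (ptrOf t p) (.adr a) ∈ up}
    | .assume (.eq p q) =>
        if ptrOf t p ∈ τ.valid ∨ ptrOf t q ∈ τ.valid then τ.valid ∪ {ptrOf t p, ptrOf t q}
        else τ.valid
    | _ => τ.valid

/-- The threads that are inside an atomic block. -/
def Comp.lockset : Comp S → Set S.Thread
  | .nil => ∅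
  | .snoc τ (.free _) => τ.lockset
  | .snoc τ (.run t c _) => match c with
    | .beginAtomic => τ.lockset ∪ {t}
    | .endAtomic => τ.lockset \ {t}
    | _ => τ.lockset

/-! ## Control flow and liberal semantics -/

/-- One step of a statement, labelled with the executed command, if any. -/
inductive Stmt.Step : Stmt S → Option (Com S) → Stmt S → Prop
  | com (c : Com S) : Step (.com c) (some c) .skip
  | seqSkip (s : Stmt S) : Step (.seq .skip s) none s
  | choiceLeft (s₁ s₂ : Stmt S) : Step (.choice s₁ s₂) none s₁
  | choiceRight (s₁ s₂ : Stmt S) : Step (.choice s₁ s₂) none s₂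
  | seq {s₁ s₁' : Stmt S} {o : Option (Com S)} (s₂ : Stmt S) :
      s₁ ≠ .skip → Step s₁ o s₁' → Step (.seq s₁ s₂) o (.seq s₁' s₂)
  | loopSkip (s : Stmt S) : Step (.loop s) none .skip
  | loopOnce (s : Stmt S) : Step (.loop s) none s
  | loopMore (s : Stmt S) : Step (.loop s) none (.seq s (.loop s))

open Classical in
/-- `Control P pc τ`: after `τ` the threads can be at the control locations `pc`, when every thread
executes `P`. While a thread is inside an atomic block, it is the only one to take steps;
outside of atomic blocks a thread can only take silent steps or enter an atomic block, and the
environment can free addresses. -/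
inductive Control (P : Stmt S) : (S.Thread → Stmt S) → Comp S → Prop
  | start : Control P (fun _ => P) .nil
  | insideSilent {pc τ t s} : Control P pc τ → (pc t).Step none s →
      τ.lockset = {t} → Control P (Function.update pc t s) τ
  | insideCom {pc τ t c s} (up : List (Upd S)) : Control P pc τ → (pc t).Step (some c) s →
      τ.lockset = {t} → Control P (Function.update pc t s) (τ.snoc (.run t c up))
  | outsideSilent {pc τ t s} : Control P pc τ → (pc t).Step none s →
      τ.lockset = ∅ → Control P (Function.update pc t s) τ
  | acquire {pc τ t c s} (up : List (Upd S)) : Control P pc τ → (pc t).Step (some c) s →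
      τ.lockset = ∅ → (τ.snoc (.run t c up)).lockset = {t} →
      Control P (Function.update pc t s) (τ.snoc (.run t c up))
  | free {pc τ} (a : S.Adr) : Control P pc τ → τ.lockset = ∅ → Control P pc (τ.snoc (.free a))

/-- `Enabled X Y τ act`: the memory after `τ` allows action `act`, when the addresses in `X` can be
freed and those in `Y` can be reallocated. -/
inductive Enabled (X Y : Set S.Adr) (τ : Comp S) : Act S → Prop
  | assign {t p q v} : τ.mem.ptr (ptrOf t q) = some v →
      Enabled X Y τ (.run t (.assign p q) [.ptr (ptrOf t p) v])
  | load {t p q a v} : τ.mem.ptr (ptrOf t q) = some (.adr a) → τ.mem.ptr (.sel a) = some v →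
      Enabled X Y τ (.run t (.load p q) [.ptr (ptrOf t p) v])
  | store {t p q a v} : τ.mem.ptr (ptrOf t p) = some (.adr a) →
      τ.mem.ptr (ptrOf t q) = some v → Enabled X Y τ (.run t (.store p q) [.ptr (.sel a) v])
  | loadData {t u q a d} : τ.mem.ptr (ptrOf t q) = some (.adr a) → τ.mem.dat (.sel a) = some d →
      Enabled X Y τ (.run t (.loadData u q) [.dat (.var t u) d])
  | storeData {t p u a d} : τ.mem.ptr (ptrOf t p) = some (.adr a) →
      τ.mem.dat (.var t u) = some d → Enabled X Y τ (.run t (.storeData p u) [.dat (.sel a) d])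
  | op {t u n F us} {ds : Fin n → S.Dom} : (∀ i, τ.mem.dat (.var t (us i)) = some (ds i)) →
      Enabled X Y τ (.run t (.op u n F us) [.dat (.var t u) (F ds)])
  | malloc {t p a} (d : S.Dom) : a ∈ τ.fresh ∨ a ∈ τ.freed ∩ Y →
      Enabled X Y τ (.run t (.malloc p)
        [.ptr (ptrOf t p) (.adr a), .ptr (.sel a) .seg, .dat (.sel a) d])
  | assumeEq {t p q} : τ.mem.ptr (ptrOf t p) = τ.mem.ptr (ptrOf t q) →
      Enabled X Y τ (.run t (.assume (.eq p q)) [])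
  | assumeNe {t p q} : τ.mem.ptr (ptrOf t p) ≠ τ.mem.ptr (ptrOf t q) →
      Enabled X Y τ (.run t (.assume (.ne p q)) [])
  | assumePred {t n R us} {ds : Fin n → S.Dom} : (∀ i, τ.mem.dat (.var t (us i)) = some (ds i)) →
      R ds → Enabled X Y τ (.run t (.assume (.pred n R us)) [])
  | beginAtomic {t} : Enabled X Y τ (.run t .beginAtomic [])
  | endAtomic {t} : Enabled X Y τ (.run t .endAtomic [])
  | enter {t f ps us} : (∀ i, τ.mem.ptr (ptrOf t (ps i)) ≠ some .seg) →
      Enabled X Y τ (.run t (.enter f ps us) [])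
  | exit {t f} : Enabled X Y τ (.run t (.exit f) [])
  | inv {t i} : Enabled X Y τ (.run t (.inv i) [])
  | free {a} : a ∈ X → Enabled X Y τ (.free a)

/-- `τ ∈ sem P X Y`: the liberal semantics of the program in which every thread executes `P`. -/
inductive Liberal (P : Stmt S) (X Y : Set S.Adr) : Comp S → Prop
  | nil : Liberal P X Y .nil
  | snoc {τ : Comp S} {act : Act S} : Liberal P X Y τ → (∃ pc, Control P pc (τ.snoc act)) →
      Enabled X Y τ act → Liberal P X Y (τ.snoc act)

def sem (P : Stmt S) (X Y : Set S.Adr) : Set (Comp S) := {τ | Liberal P X Y τ}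

/-! ## Invariant annotations -/

open Classical in
/-- `τ.Sat ρ`: there is a choice of a set of addresses for every allocation of an angel in `τ` under
which all annotations in `τ` hold, and under which `ρ t r` is the set held by `t`'s angel `r` after
`τ`. Angels that have not been allocated hold the empty set. -/
noncomputable def Comp.Sat : Comp S → (S.Thread → S.AVar → Set S.Adr) → Prop
  | .nil => fun ρ => ρ = fun _ _ => ∅
  | .snoc τ (.free _) => τ.Sat
  | .snoc τ (.run t c _) => match c with
    | .inv (.angel r) => fun ρ => ∃ ρ₀ A, τ.Sat ρ₀ ∧
        ρ = Function.update ρ₀ t (Function.update (ρ₀ t) r A)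
    | .inv (.eq p q) => fun ρ => τ.Sat ρ ∧ τ.mem.ptr (ptrOf t p) = τ.mem.ptr (ptrOf t q)
    | .inv (.mem p r) => fun ρ => τ.Sat ρ ∧ ∃ a ∈ ρ t r, τ.mem.ptr (ptrOf t p) = some (.adr a)
    | .inv (.activePtr p) => fun ρ => τ.Sat ρ ∧
        ∃ a ∈ τ.active, τ.mem.ptr (ptrOf t p) = some (.adr a)
    | .inv (.activeAngel r) => fun ρ => τ.Sat ρ ∧ ρ t r ⊆ τ.active
    | _ => τ.Sat

/-- The invariant annotations hold for `τ`. -/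
def Comp.InvHolds (τ : Comp S) : Prop := ∃ ρ, τ.Sat ρ

/-- The addresses possibly held by `t`'s angel `r` after `τ`. -/
def Comp.denotation (τ : Comp S) (t : S.Thread) (r : S.AVar) : Set S.Adr :=
  {a | ∃ ρ, τ.Sat ρ ∧ a ∈ ρ t r}

/-! ## SMR automata -/

/-- Event types: calls and returns of SMR functions, and frees. -/
inductive Label (S : Sig) : Type
  | enter (f : S.Fn)
  | exit (f : S.Fn)
  | free

/-- Numbers of thread, address and data parameters of an event type. -/
def Label.nThr : Label S → ℕ
  | .enter _ => 1
  | .exit _ => 1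
  | .free => 0

def Label.nAdr : Label S → ℕ
  | .enter f => S.nPtr f
  | .exit _ => 0
  | .free => 1

def Label.nDat : Label S → ℕ
  | .enter f => S.nDat f
  | .exit _ => 0
  | .free => 0

/-- Events `f(t, a₁,…,aₙ, d₁,…,dₖ)`, `exit f(t)` and `free(a)`. -/
inductive Event (S : Sig) : Type
  | enter (f : S.Fn) (t : S.Thread) (as : Fin (S.nPtr f) → S.Adr) (ds : Fin (S.nDat f) → S.Dom)
  | exit (f : S.Fn) (t : S.Thread)
  | free (a : S.Adr)

namespace Event

def label : Event S → Label S
  | .enter f _ _ _ => .enter f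
  | .exit f _ => .exit f
  | .free _ => .free

/-- The executing thread; `none` is `⊥`. -/
def thread : Event S → Option S.Thread
  | .enter _ t _ _ => some t
  | .exit _ t => some t
  | .free _ => none

def thrParam : (e : Event S) → Fin e.label.nThr → S.Thread
  | .enter _ t _ _ => fun _ => t
  | .exit _ t => fun _ => t
  | .free _ => fun i => i.elim0

def adrParam : (e : Event S) → Fin e.label.nAdr → S.Adr
  | .enter _ _ as _ => as
  | .exit _ _ => fun i => i.elim0
  | .free a => fun _ => a

def datParam : (e : Event S) → Fin e.label.nDat → S.Dom
  | .enter _ _ _ ds => ds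
  | .exit _ _ => fun i => i.elim0
  | .free _ => fun i => i.elim0

end Event

/-- The variables of SMR automata store thread identifiers or addresses; `zt` and `za` are the
distinguished variables. -/
structure AutVars where
  TV : Type
  AV : Type
  zt : TV
  za : AV

structure Valuation (S : Sig) (V : AutVars) where
  thr : V.TV → S.Thread
  adr : V.AV → S.Adr

/-- Guards are Boolean formulas over equalities of variables, parameters and data constants. -/
inductive Guard (S : Sig) (V : AutVars) (ℓ : Label S) : Type
  | tt
  | thrEq (x y : V.TV ⊕ Fin ℓ.nThr)
  | adrEq (x y : V.AV ⊕ Fin ℓ.nAdr)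
  | datEq (x y : S.Dom ⊕ Fin ℓ.nDat)
  | not (g : Guard S V ℓ)
  | and (g₁ g₂ : Guard S V ℓ)
  | or (g₁ g₂ : Guard S V ℓ)

variable {V : AutVars}

def Guard.Holds (φ : Valuation S V) (e : Event S) : Guard S V e.label → Prop
  | .tt => True
  | .thrEq x y => Sum.elim φ.thr e.thrParam x = Sum.elim φ.thr e.thrParam y
  | .adrEq x y => Sum.elim φ.adr e.adrParam x = Sum.elim φ.adr e.adrParam y
  | .datEq x y => Sum.elim id e.datParam x = Sum.elim id e.datParam y
  | .not g => ¬ g.Holds φ e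
  | .and g₁ g₂ => g₁.Holds φ e ∧ g₂.Holds φ e
  | .or g₁ g₂ => g₁.Holds φ e ∨ g₂.Holds φ e

structure Transition (S : Sig) (V : AutVars) (Loc : Type) where
  src : Loc
  label : Label S
  guard : Guard S V label
  tgt : Loc

/-- SMR automata. Finiteness of the components plays no role and is not imposed. -/
structure Automaton (S : Sig) (V : AutVars) where
  Loc : Type
  initial : Loc
  accepting : Set Loc
  trans : Set (Transition S V Loc)

namespace Automaton

/-- The SMR step from state `(l, φ)` to state `(l', φ)` under event `e`. -/
def Step (O : Automaton S V) (φ : Valuation S V) (l : O.Loc) (e : Event S) (l' : O.Loc) : Prop :=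
  ∃ g : Guard S V e.label, ⟨l, e.label, g, l'⟩ ∈ O.trans ∧ g.Holds φ e

/-- Sequences of SMR steps from `(l, φ)` to `(l', φ)` under a history. -/
def Run (O : Automaton S V) (φ : Valuation S V) (l : O.Loc) : List (Event S) → O.Loc → Prop
  | [], l' => l = l'
  | e :: h, l' => ∃ l₁, O.Step φ l e l₁ ∧ O.Run φ l₁ h l'

/-- The specification of `O`: the histories that are not accepted. -/
def spec (O : Automaton S V) : Set (List (Event S)) :=
  {h | ∀ φ l, O.Run φ O.initial h l → l ∉ O.accepting}

/-- `O.freeable h c`: the continuations of `h` that comply with `O` and free at most `c`. -/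
def freeable (O : Automaton S V) (h : List (Event S)) (c : S.Adr) : Set (List (Event S)) :=
  {h' | h ++ h' ∈ O.spec ∧ ∀ a, Event.free a ∈ h' → a = c}

/-- Every state has a step for every event. -/
def Complete (O : Automaton S V) : Prop :=
  ∀ (φ : Valuation S V) (l : O.Loc) (e : Event S), ∃ l', O.Step φ l e l'

/-- Accepting states are reached only with frees and are not left. -/
structure AcceptsByFree (O : Automaton S V) : Prop where
  initial_notMem : O.initial ∉ O.accepting
  free_of_step : ∀ (φ : Valuation S V) (l : O.Loc) (e : Event S) (l' : O.Loc),
    O.Step φ l e l' → l ∉ O.accepting → l' ∈ O.accepting → ∃ a, e = .free a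
  step_mem : ∀ (φ : Valuation S V) (l : O.Loc) (e : Event S) (l' : O.Loc),
    O.Step φ l e l' → l ∈ O.accepting → l' ∈ O.accepting

/-- The product of two automata over the same variables. It accepts if one of the factors does. -/
def prod (O₁ O₂ : Automaton S V) : Automaton S V where
  Loc := O₁.Loc × O₂.Loc
  initial := (O₁.initial, O₂.initial)
  accepting := {l | l.1 ∈ O₁.accepting ∨ l.2 ∈ O₂.accepting}
  trans := {T | ∃ g₁ g₂, ⟨T.src.1, T.label, g₁, T.tgt.1⟩ ∈ O₁.trans ∧
    ⟨T.src.2, T.label, g₂, T.tgt.2⟩ ∈ O₂.trans ∧ T.guard = .and g₁ g₂}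

end Automaton

inductive BaseLoc : Type
  | init
  | retired
  | final

/-- The guard `a = za` on `retire(t, a)`. -/
def retireGuard (S : Sig) (V : AutVars) : Guard S V (.enter S.retire) :=
  .adrEq (.inr ⟨0, by simp [Label.nAdr, S.nPtr_retire]⟩) (.inl V.za)

/-- The guard `a = za` on `free(a)`. -/
def freeGuard (S : Sig) (V : AutVars) : Guard S V .free :=
  .adrEq (.inr ⟨0, by simp [Label.nAdr]⟩) (.inl V.za)

/-- The transitions of the base automaton, including the self-loops. -/
inductive BaseTrans (S : Sig) (V : AutVars) : Transition S V BaseLoc → Prop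
  | retire : BaseTrans S V ⟨.init, .enter S.retire, retireGuard S V, .retired⟩
  | free : BaseTrans S V ⟨.retired, .free, freeGuard S V, .init⟩
  | fault : BaseTrans S V ⟨.init, .free, freeGuard S V, .final⟩
  | initRetire : BaseTrans S V ⟨.init, .enter S.retire, .not (retireGuard S V), .init⟩
  | retiredRetire : BaseTrans S V ⟨.retired, .enter S.retire, .tt, .retired⟩
  | initFree : BaseTrans S V ⟨.init, .free, .not (freeGuard S V), .init⟩
  | retiredFree : BaseTrans S V ⟨.retired, .free, .not (freeGuard S V), .retired⟩
  | initEnter (f : S.Fn) : f ≠ S.retire → BaseTrans S V ⟨.init, .enter f, .tt, .init⟩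
  | retiredEnter (f : S.Fn) : f ≠ S.retire → BaseTrans S V ⟨.retired, .enter f, .tt, .retired⟩
  | initExit (f : S.Fn) : BaseTrans S V ⟨.init, .exit f, .tt, .init⟩
  | retiredExit (f : S.Fn) : BaseTrans S V ⟨.retired, .exit f, .tt, .retired⟩
  | finalLoop (ℓ : Label S) : BaseTrans S V ⟨.final, ℓ, .tt, .final⟩

/-- The base automaton: address `za` may be freed only if it has been retired and not freed since. -/
def baseAut (S : Sig) (V : AutVars) : Automaton S V where
  Loc := BaseLoc
  initial := .init
  accepting := {.final}
  trans := {T | BaseTrans S V T}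

/-- The SMR automaton: the product of the base automaton with a further automaton. -/
def smrAut (B : Automaton S V) : Automaton S V := (baseAut S V).prod B

open Classical in
/-- The event emitted when thread `t` executes a command under memory `m`, if any. -/
noncomputable def Com.event (t : S.Thread) (m : Mem S) : Com S → Option (Event S)
  | .enter f ps us =>
      if h : ∃ x : (Fin (S.nPtr f) → S.Adr) × (Fin (S.nDat f) → S.Dom),
          (∀ i, m.ptr (ptrOf t (ps i)) = some (.adr (x.1 i))) ∧
          (∀ j, m.dat (.var t (us j)) = some (x.2 j)) then
        some (.enter f t h.choose.1 h.choose.2)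
      else none
  | .exit f => some (.exit f t)
  | _ => none

/-- The history induced by a computation. -/
noncomputable def Comp.history : Comp S → List (Event S)
  | .nil => []
  | .snoc τ (.free a) => τ.history ++ [.free a]
  | .snoc τ (.run t c _) => τ.history ++ (c.event t τ.mem).toList

/-- The SMR semantics induced by `O` with freeable addresses `X` and reallocatable addresses `Y`. -/
def smrSem (O : Automaton S V) (P : Stmt S) (X Y : Set S.Adr) : Set (Comp S) :=
  {τ | τ ∈ sem P X Y ∧ τ.history ∈ O.spec}

/-! ## Types -/

/-- `L` is closed under interference from other threads: no event issued by a thread different from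
the one stored in `zt`, and no free (which is issued by `⊥`), leads from `L` out of `L`. -/
def Automaton.Closed (O : Automaton S V) (L : Set O.Loc) : Prop :=
  ∀ (φ : Valuation S V) (l : O.Loc) (e : Event S) (l' : O.Loc),
    O.Step φ l e l' → l ∈ L → e.thread ≠ some (φ.thr V.zt) → l' ∈ L

/-- The largest set of locations that is closed under interference and in which freeing the address
stored in `za` leads to accepting locations only. -/
def Automaton.safeLoc (O : Automaton S V) : Set O.Loc :=
  ⋃₀ {L | O.Closed L ∧ ∀ l ∈ L, ∀ (φ : Valuation S V) (l' : O.Loc),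
    O.Step φ l (.free (φ.adr V.za)) l' → l' ∈ O.accepting}

/-- The guarantees `𝕃`, `𝔸`, `𝕊`, and `𝔼_L` for sets `L` closed under interference. -/
inductive Guarantee (B : Automaton S V) : Type
  | loc
  | act
  | safe
  | custom (L : Set (smrAut B).Loc) (hL : (smrAut B).Closed L)

/-- Types are sets of guarantees, to be read as intersections. -/
abbrev Ty (B : Automaton S V) := Set (Guarantee B)

def Guarantee.locs {B : Automaton S V} : Guarantee B → Set (smrAut B).Loc
  | .loc => {l | l.1 = BaseLoc.init}
  | .act => {l | l.1 = BaseLoc.init}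
  | .safe => (smrAut B).safeLoc
  | .custom L _ => L

/-- The locations associated with a type. -/
def tyLocs {B : Automaton S V} (T : Ty B) : Set (smrAut B).Loc := {l | ∀ g ∈ T, l ∈ g.locs}

def IsValid {B : Automaton S V} (T : Ty B) : Prop :=
  Guarantee.loc ∈ T ∨ Guarantee.act ∈ T ∨ Guarantee.safe ∈ T

/-- Type environments for pointers (`Sum.inl p`) and angels (`Sum.inr r`). -/
abbrev Env (B : Automaton S V) := S.PVar ⊕ S.AVar → Ty B

def Env.initial (B : Automaton S V) : Env B := fun _ => ∅

/-- The post-image of a set of locations under a command. For a pointer `p`, the automaton tracks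
the thread executing the command and the address held by `p`; for an angel, only the thread. -/
def post (B : Automaton S V) (x : S.PVar ⊕ S.AVar) (c : Com S) (L : Set (smrAut B).Loc) :
    Set (smrAut B).Loc :=
  {l' | ∃ (t : S.Thread) (m : Mem S) (φ : Valuation S V) (e : Event S), ∃ l ∈ L,
    c.event t m = some e ∧ (smrAut B).Step φ l e l' ∧ φ.thr V.zt = t ∧
    ∀ p, x = .inl p → m.ptr (ptrOf t p) = some (.adr (φ.adr V.za))}

/-- The type transformer relation for a given post-image. -/
def TransformsTy {B : Automaton S V} (pst : Set (smrAut B).Loc → Set (smrAut B).Loc)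
    (T T' : Ty B) : Prop :=
  pst (tyLocs T) ⊆ tyLocs T' ∧ (IsValid T' → IsValid T) ∧
    {Guarantee.loc, Guarantee.act} ∩ T' ⊆ {Guarantee.loc, Guarantee.act} ∩ T

def Transforms {B : Automaton S V} (Γ : Env B) (c : Com S) (Γ' : Env B) : Prop :=
  ∀ x, TransformsTy (post B x c) (Γ x) (Γ' x)

def TransformsEps {B : Automaton S V} (Γ Γ' : Env B) : Prop :=
  ∀ x, TransformsTy id (Γ x) (Γ' x)

/-- A call `f(p₁,…,pₙ,u₁,…,uₖ)` does not exhibit new behaviour of the SMR automaton when the values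
of the arguments that are not known to be valid are replaced. -/
def SafeCall {B : Automaton S V} (Γ : Env B) (f : S.Fn) (ps : Fin (S.nPtr f) → S.PVar) : Prop :=
  ∀ (h : List (Event S)) (t : S.Thread) (as bs : Fin (S.nPtr f) → S.Adr) (c : S.Adr)
    (ds : Fin (S.nDat f) → S.Dom),
    (∀ i, as i = c ∨ IsValid (Γ (.inl (ps i))) → as i = bs i) →
    (smrAut B).freeable (h ++ [.enter f t bs ds]) c ⊆
      (smrAut B).freeable (h ++ [.enter f t as ds]) c

open Classical in
/-- Removal of the guarantees that can be invalidated outside of atomic blocks. -/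
noncomputable def rmTransient {B : Automaton S V} (Γ : Env B) : Env B
  | .inl p => if p ∈ S.shared then ∅ else Γ (.inl p) \ {Guarantee.act}
  | .inr r => Γ (.inr r) \ {Guarantee.act}

open Classical in
/-- Derivability of type judgements `{Γ} stmt {Γ'}`. -/
inductive Typed (B : Automaton S V) : Env B → Stmt S → Env B → Prop
  | assign1 {Γ : Env B} {p q : S.PVar} :
      Typed B Γ (.com (.assign p q))
        (Function.update (Function.update Γ (.inl p) (Γ (.inl q) \ {Guarantee.loc}))
          (.inl q) (Γ (.inl q) \ {Guarantee.loc}))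
  | assign2 {Γ : Env B} {p q : S.PVar} : IsValid (Γ (.inl q)) →
      Typed B Γ (.com (.load p q)) (Function.update Γ (.inl p) ∅)
  | assign3 {Γ : Env B} {p q : S.PVar} : IsValid (Γ (.inl p)) →
      Typed B Γ (.com (.store p q))
        (Function.update Γ (.inl q) (Γ (.inl q) \ {Guarantee.loc}))
  | assign4 {Γ : Env B} {u : S.DVar} {n : ℕ} {F : (Fin n → S.Dom) → S.Dom} {us : Fin n → S.DVar} :
      Typed B Γ (.com (.op u n F us)) Γ
  | assign5 {Γ : Env B} {u : S.DVar} {q : S.PVar} : IsValid (Γ (.inl q)) →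
      Typed B Γ (.com (.loadData u q)) Γ
  | assign6 {Γ : Env B} {p : S.PVar} {u : S.DVar} : IsValid (Γ (.inl p)) →
      Typed B Γ (.com (.storeData p u)) Γ
  | malloc {Γ : Env B} {p : S.PVar} : p ∉ S.shared →
      Typed B Γ (.com (.malloc p)) (Function.update Γ (.inl p) {Guarantee.loc})
  | assume1 {Γ : Env B} {p q : S.PVar} : IsValid (Γ (.inl p)) → IsValid (Γ (.inl q)) →
      Typed B Γ (.com (.assume (.eq p q)))
        (Function.update
          (Function.update Γ (.inl p) ((Γ (.inl p) ∪ Γ (.inl q)) \ {Guarantee.loc}))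
          (.inl q) ((Γ (.inl p) ∪ Γ (.inl q)) \ {Guarantee.loc}))
  | assume2 {Γ : Env B} {cond : Cond S} : (∀ p q, cond ≠ .eq p q) →
      Typed B Γ (.com (.assume cond)) Γ
  | equal {Γ : Env B} {p q : S.PVar} :
      Typed B Γ (.com (.inv (.eq p q)))
        (Function.update (Function.update Γ (.inl p) (Γ (.inl p) ∪ Γ (.inl q)))
          (.inl q) (Γ (.inl p) ∪ Γ (.inl q)))
  | activePtr {Γ : Env B} {p : S.PVar} :
      Typed B Γ (.com (.inv (.activePtr p)))
        (Function.update Γ (.inl p) (Γ (.inl p) ∪ {Guarantee.act}))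
  | activeAngel {Γ : Env B} {r : S.AVar} :
      Typed B Γ (.com (.inv (.activeAngel r)))
        (Function.update Γ (.inr r) (Γ (.inr r) ∪ {Guarantee.act}))
  | angel {Γ : Env B} {r : S.AVar} :
      Typed B Γ (.com (.inv (.angel r))) (Function.update Γ (.inr r) ∅)
  | member {Γ : Env B} {p : S.PVar} {r : S.AVar} :
      Typed B Γ (.com (.inv (.mem p r)))
        (Function.update Γ (.inl p) (Γ (.inl p) ∪ Γ (.inr r)))
  | enter {Γ Γ' : Env B} {f : S.Fn} {ps : Fin (S.nPtr f) → S.PVar} {us : Fin (S.nDat f) → S.DVar} :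
      SafeCall Γ f ps → Transforms Γ (.enter f ps us) Γ' →
      (f = S.retire → ∀ i, Guarantee.act ∈ Γ (.inl (ps i))) →
      Typed B Γ (.com (.enter f ps us)) Γ'
  | exit {Γ Γ' : Env B} {f : S.Fn} : Transforms Γ (.exit f) Γ' → Typed B Γ (.com (.exit f)) Γ'
  | skip {Γ : Env B} : Typed B Γ .skip Γ
  | infer {Γ₁ Γ₂ Γ₃ Γ₄ : Env B} {s : Stmt S} : TransformsEps Γ₁ Γ₂ → Typed B Γ₂ s Γ₃ →
      TransformsEps Γ₃ Γ₄ → Typed B Γ₁ s Γ₄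
  | beginAtomic {Γ : Env B} : Typed B Γ (.com .beginAtomic) Γ
  | endAtomic {Γ : Env B} : Typed B Γ (.com .endAtomic) (rmTransient Γ)
  | seq {Γ Γ' Γ'' : Env B} {s₁ s₂ : Stmt S} : Typed B Γ s₁ Γ' → Typed B Γ' s₂ Γ'' →
      Typed B Γ (.seq s₁ s₂) Γ''
  | choice {Γ Γ' : Env B} {s₁ s₂ : Stmt S} : Typed B Γ s₁ Γ' → Typed B Γ s₂ Γ' →
      Typed B Γ (.choice s₁ s₂) Γ'
  | loop {Γ : Env B} {s : Stmt S} : Typed B Γ s Γ → Typed B Γ (.loop s) Γ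

/-! ## Semantic soundness -/

/-- The addresses held by pointer or angel `x` of thread `t` after `τ`. -/
def Comp.addresses (τ : Comp S) (t : S.Thread) : S.PVar ⊕ S.AVar → Set S.Adr
  | .inl p => {a | τ.mem.ptr (ptrOf t p) = some (.adr a)}
  | .inr r => τ.denotation t r

/-- `τ, t ⊨ Γ`: for every address `a` held by some `x`, when the automaton tracks `t` and `a`, the
history of `τ` reaches a location associated with the type of `x`, and reaches no other location. -/
def Models {B : Automaton S V} (τ : Comp S) (t : S.Thread) (Γ : Env B) : Prop :=
  ∀ x, ∀ a ∈ τ.addresses t x, ∀ φ : Valuation S V, φ.thr V.zt = t → φ.adr V.za = a →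
    (∃ l ∈ tyLocs (Γ x), (smrAut B).Run φ (smrAut B).initial τ.history l) ∧
    ∀ l, (smrAut B).Run φ (smrAut B).initial τ.history l → l ∈ tyLocs (Γ x)

/-- Thread `t` can have executed its program `P` to completion after `τ`. -/
def Completes (P : Stmt S) (τ : Comp S) (t : S.Thread) : Prop :=
  ∃ pc, Control P pc τ ∧ pc t = .skip

/-- Semantic soundness of `{Γ_init} P {Γ}` for computations of the SMR semantics in which all
addresses may be freed and none may be reallocated. -/
def SemSound (B : Automaton S V) (P : Stmt S) (Γ : Env B) : Prop :=
  ∀ τ ∈ smrSem (smrAut B) P Set.univ ∅, ∀ t, Completes P τ t →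
    Models τ t Γ ∧ ∀ p, IsValid (Γ (.inl p)) → ptrOf t p ∈ τ.valid

end SMR

namespace SMR

variable {S : Sig} {V : AutVars}

/-! ## Runs of SMR automata -/

namespace Automaton

/-! The annotations are known to hold only in computations that free nothing, so they are first
transferred. Without reallocation, deleting the frees from a computation yields a garbage-collected
one with the same memory and control (`Liberal.eraseFrees`). The base automaton permits only retired
addresses to be freed, so the addresses retired in the stripped computation are exactly those freed
or retired in the original (`Liberal.retired_eraseFrees`). Active addresses therefore agree, and
with them the truth of all annotations (`Liberal.invHolds`).

The rest is an induction over the control flow (`Control.exists_progInv`). Each thread carries an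
environment from which the remainder of its program is derivable (`Typed.step`) and which describes
its pointers and angels (`ThreadInv`): runs of the automaton end in the locations of the type, an
address of valid type has not been freed, and an address held under 𝕃 occurs nowhere else in memory.
The thread's own commands preserve this by the typing rules (`Typed.threadInv_run`).

Other threads and the environment act only while the thread is outside its atomic blocks. Its
environment is then `Stable`: there is no 𝔸, and shared pointers promise nothing. The remaining
guarantees survive: 𝔼 and 𝕊 are closed under interference, and 𝕃 because nobody else has a reference
with which to retire the address. Freeing an address of type 𝕃 or 𝕊 would make the automaton accept,
which the specification excludes (`Comp.HasTy.free`).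

Validity reduces to absence of frees: without reallocation, a variable is valid iff it does not hold
a freed address, provided loads never go through freed addresses (`Comp.ValidIffLive`). The typing
rule for loads ensures the proviso. -/

theorem run_append_singleton (O : Automaton S V) {φ : Valuation S V} {h : List (Event S)}
    {e : Event S} {l l' : O.Loc} :
    O.Run φ l (h ++ [e]) l' ↔ ∃ l₁, O.Run φ l h l₁ ∧ O.Step φ l₁ e l' := by
  induction h generalizing l with
  | nil => simp [Run]
  | cons e' h ih =>
    simp only [List.cons_append, Run, ih]
    constructor
    · rintro ⟨l₁, hs, l₂, hr, hs'⟩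
      exact ⟨l₂, ⟨l₁, hs, hr⟩, hs'⟩
    · rintro ⟨l₂, ⟨l₁, hs, hr⟩, hs'⟩
      exact ⟨l₁, hs, l₂, hr, hs'⟩

theorem Complete.exists_run {O : Automaton S V} (hO : O.Complete) (φ : Valuation S V)
    (l : O.Loc) (h : List (Event S)) : ∃ l', O.Run φ l h l' := by
  induction h generalizing l with
  | nil => exact ⟨l, rfl⟩
  | cons e h ih =>
    obtain ⟨l₁, h₁⟩ := hO φ l e
    obtain ⟨l₂, h₂⟩ := ih l₁
    exact ⟨l₂, l₁, h₁, h₂⟩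

/-- Completeness extends an accepting run by one step, and acceptance is never left; hence
specifications are prefix-closed. -/
theorem mem_spec_of_append_singleton {O : Automaton S V} (hO : O.Complete) (hA : O.AcceptsByFree)
    {h : List (Event S)} {e : Event S} (hs : h ++ [e] ∈ O.spec) : h ∈ O.spec := by
  intro φ l hr hl
  obtain ⟨l', hl'⟩ := hO φ l e
  exact hs φ l' (O.run_append_singleton.2 ⟨l, hr, hl'⟩) (hA.step_mem φ l e l' hl' hl)

theorem closed_safeLoc (O : Automaton S V) : O.Closed O.safeLoc := by
  rintro φ l e l' hs ⟨L, hL, hl⟩ he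
  exact ⟨L, hL, hL.1 φ l e l' hs hl he⟩

theorem mem_accepting_of_mem_safeLoc (O : Automaton S V) {φ : Valuation S V} {l l' : O.Loc}
    (hl : l ∈ O.safeLoc) (hs : O.Step φ l (.free (φ.adr V.za)) l') : l' ∈ O.accepting := by
  obtain ⟨L, hL, hl⟩ := hl
  exact hL.2 l hl φ l' hs

end Automaton

/-! ## The base automaton -/

theorem baseAut_step_of_smrAut_step {B : Automaton S V} {φ : Valuation S V} {l l' : (smrAut B).Loc}
    {e : Event S} (h : (smrAut B).Step φ l e l') : (baseAut S V).Step φ l.1 e l'.1 := by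
  obtain ⟨g, hg, hh⟩ := h
  change ∃ g₁ g₂, (⟨l.1, e.label, g₁, l'.1⟩ : Transition S V _) ∈ (baseAut S V).trans ∧ _ ∧
    g = .and g₁ g₂ at hg
  obtain ⟨g₁, g₂, h₁, -, rfl⟩ := hg
  exact ⟨g₁, h₁, hh.1⟩

/-- The event `retire(t, a)` for some thread `t`. -/
def Event.IsRetire (e : Event S) (a : S.Adr) : Prop :=
  ∃ t as ds, e = .enter S.retire t as ds ∧ ∃ i, as i = a

/-- Inspection of the transitions. It makes the location `retired` follow the set `Comp.retired`,
which changes on the same events. -/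
theorem baseAut_step_retired {φ : Valuation S V} {l : BaseLoc} {e : Event S}
    (h : (baseAut S V).Step φ l e BaseLoc.retired) :
    l = .retired ∧ e ≠ .free (φ.adr V.za) ∨ e.IsRetire (φ.adr V.za) := by
  obtain ⟨g, hg, hh⟩ := h
  change BaseTrans S V _ at hg
  cases e <;> cases hg
  · exact .inr ⟨_, _, _, rfl, _, hh⟩
  · exact .inl ⟨rfl, by simp⟩
  · exact .inl ⟨rfl, by simp⟩
  · exact .inl ⟨rfl, by simp⟩
  · refine .inl ⟨rfl, ?_⟩
    rintro ⟨⟩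
    exact hh rfl

theorem baseAut_step_init {φ : Valuation S V} {l : BaseLoc} {e : Event S}
    (h : (baseAut S V).Step φ BaseLoc.init e l) :
    l = .init ∨ l = .final ∨ e.IsRetire (φ.adr V.za) := by
  obtain ⟨g, hg, hh⟩ := h
  change BaseTrans S V _ at hg
  cases e <;> cases hg
  · exact .inr (.inr ⟨_, _, _, rfl, _, hh⟩)
  all_goals simp

theorem baseAut_step_init_free {φ : Valuation S V} {l : BaseLoc}
    (h : (baseAut S V).Step φ BaseLoc.init (.free (φ.adr V.za)) l) : l = .final := by
  obtain ⟨g, hg, hh⟩ := h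
  change BaseTrans S V _ at hg
  cases hg
  · rfl
  · exact absurd rfl hh

theorem fst_ne_final_of_mem_spec {B : Automaton S V} {h : List (Event S)}
    (hs : h ∈ (smrAut B).spec) {φ : Valuation S V} {l : (smrAut B).Loc}
    (hr : (smrAut B).Run φ (smrAut B).initial h l) : l.1 ≠ BaseLoc.final :=
  fun hl => hs φ l hr (.inl hl)

/-! ## Histories -/

theorem Com.event_eq_some {t : S.Thread} {m : Mem S} {c : Com S} {e : Event S}
    (h : c.event t m = some e) :
    (∃ f ps us as ds, c = .enter f ps us ∧ e = .enter f t as ds ∧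
      ∀ i, m.ptr (ptrOf t (ps i)) = some (.adr (as i))) ∨ ∃ f, c = .exit f ∧ e = .exit f t := by
  cases c <;> simp only [Com.event, reduceCtorEq] at h
  case enter f ps us =>
    split_ifs at h with hx
    cases h
    exact .inl ⟨f, ps, us, _, _, rfl, rfl, hx.choose_spec.1⟩
  case exit f =>
    cases h
    exact .inr ⟨f, rfl, rfl⟩

theorem Com.thread_event {t : S.Thread} {m : Mem S} {c : Com S} {e : Event S}
    (h : c.event t m = some e) : e.thread = some t := by
  obtain ⟨f, ps, us, as, ds, -, rfl, -⟩ | ⟨f, -, rfl⟩ := Com.event_eq_some h <;> rfl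

theorem Comp.history_run_none {τ : Comp S} {t : S.Thread} {c : Com S} {up : List (Upd S)}
    (h : c.event t τ.mem = none) : (τ.snoc (.run t c up)).history = τ.history := by
  simp [Comp.history, h]

theorem Comp.history_run_some {τ : Comp S} {t : S.Thread} {c : Com S} {up : List (Upd S)}
    {e : Event S} (h : c.event t τ.mem = some e) :
    (τ.snoc (.run t c up)).history = τ.history ++ [e] := by
  simp [Comp.history, h]

theorem mem_spec_of_snoc {O : Automaton S V} (hO : O.Complete) (hA : O.AcceptsByFree)
    {τ : Comp S} {act : Act S} (h : (τ.snoc act).history ∈ O.spec) : τ.history ∈ O.spec := by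
  cases act with
  | free a => exact Automaton.mem_spec_of_append_singleton hO hA h
  | run t c up =>
    cases he : c.event t τ.mem with
    | none => rwa [Comp.history_run_none he] at h
    | some e =>
      rw [Comp.history_run_some he] at h
      exact Automaton.mem_spec_of_append_singleton hO hA h

theorem Comp.retired_subset_run (τ : Comp S) (t : S.Thread) (c : Com S) (up : List (Upd S)) :
    τ.retired ⊆ (τ.snoc (.run t c up)).retired := by
  cases c <;> simp only [Comp.retired, subset_refl]
  split_ifs
  · exact Set.subset_union_left
  · exact subset_rfl

theorem Comp.mem_retired_of_isRetire {τ : Comp S} {t : S.Thread} {c : Com S} {up : List (Upd S)}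
    {e : Event S} {a : S.Adr} (he : c.event t τ.mem = some e) (h : e.IsRetire a) :
    a ∈ (τ.snoc (.run t c up)).retired := by
  obtain ⟨t', as', ds', rfl, i, rfl⟩ := h
  obtain ⟨f, ps, us, as, ds, rfl, he', hm⟩ | ⟨f, -, he'⟩ := Com.event_eq_some he
  · cases he'
    simp only [Comp.retired, if_true]
    exact .inr ⟨i, hm i⟩
  · cases he'

/-- Location and set evolve in parallel: `retired` is entered only when the tracked address is
retired and is not kept when that address is freed. Only this direction is needed. -/
theorem mem_retired_of_run {B : Automaton S V} {φ : Valuation S V} {τ : Comp S}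
    {l : (smrAut B).Loc} (hr : (smrAut B).Run φ (smrAut B).initial τ.history l)
    (hl : l.1 = BaseLoc.retired) : φ.adr V.za ∈ τ.retired := by
  induction τ generalizing l with
  | nil =>
    cases hr
    exact absurd hl (by simp [smrAut, Automaton.prod, baseAut])
  | snoc τ act ih =>
    cases act with
    | free a =>
      obtain ⟨l₁, hr₁, hs⟩ := (smrAut B).run_append_singleton.1 hr
      have hs := baseAut_step_of_smrAut_step hs
      rw [hl] at hs
      obtain ⟨hl₁, hne⟩ | ⟨_, _, _, he, _⟩ := baseAut_step_retired hs
      · refine ⟨ih hr₁ hl₁, ?_⟩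
        rintro rfl
        exact hne rfl
      · cases he
    | run t c up =>
      cases he : c.event t τ.mem with
      | none =>
        rw [Comp.history_run_none he] at hr
        exact τ.retired_subset_run t c up (ih hr hl)
      | some e =>
        rw [Comp.history_run_some he] at hr
        obtain ⟨l₁, hr₁, hs⟩ := (smrAut B).run_append_singleton.1 hr
        have hs := baseAut_step_of_smrAut_step hs
        rw [hl] at hs
        obtain ⟨hl₁, -⟩ | hret := baseAut_step_retired hs
        · exact τ.retired_subset_run t c up (ih hr₁ hl₁)
        · exact Comp.mem_retired_of_isRetire he hret

/-- Of the three base locations, `final` contradicts the specification and `retired` would put the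
address into the retired set. -/
theorem fst_eq_init_of_notMem_retired {B : Automaton S V} {φ : Valuation S V} {τ : Comp S}
    (hs : τ.history ∈ (smrAut B).spec) {l : (smrAut B).Loc}
    (hr : (smrAut B).Run φ (smrAut B).initial τ.history l) (ha : φ.adr V.za ∉ τ.retired) :
    l.1 = BaseLoc.init := by
  have h₁ := fst_ne_final_of_mem_spec hs hr
  have h₂ := mt (mem_retired_of_run hr) ha
  cases h : l.1
  · rfl
  · exact absurd h h₂
  · exact absurd h h₁

/-- The valuation that tracks a thread and an address. -/
def Valuation.track (V : AutVars) (t : S.Thread) (a : S.Adr) : Valuation S V :=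
  ⟨fun _ => t, fun _ => a⟩

/-- Were `a` not retired, tracking it would leave the base automaton in `init`, where freeing `a`
leads to `final`. The thread `t` serves only to build a valuation. -/
theorem mem_retired_of_free_mem_spec {B : Automaton S V} (hO : (smrAut B).Complete) (t : S.Thread)
    {τ : Comp S} {a : S.Adr} (hs : (τ.snoc (.free a)).history ∈ (smrAut B).spec)
    (hs' : τ.history ∈ (smrAut B).spec) : a ∈ τ.retired := by
  by_contra ha
  obtain ⟨l, hl⟩ := hO.exists_run (Valuation.track V t a) (smrAut B).initial τ.history
  obtain ⟨l', hl'⟩ := hO (Valuation.track V t a) l (.free a)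
  have hi := fst_eq_init_of_notMem_retired hs' hl ha
  have hf := baseAut_step_of_smrAut_step hl'
  rw [hi] at hf
  exact fst_ne_final_of_mem_spec hs ((smrAut B).run_append_singleton.2 ⟨l, hl, hl'⟩)
    (baseAut_step_init_free hf)

/-! ## Well-formed memories -/

@[simp] theorem ptrOf_ne_sel (t : S.Thread) (p : S.PVar) (a : S.Adr) : ptrOf t p ≠ .sel a := by
  unfold ptrOf
  split_ifs <;> simp

@[simp] theorem sel_ne_ptrOf (t : S.Thread) (p : S.PVar) (a : S.Adr) : .sel a ≠ ptrOf t p :=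
  (ptrOf_ne_sel t p a).symm

theorem ptrOf_eq_var (t : S.Thread) (p : S.PVar) : ∃ x, ptrOf t p = .var x := by
  unfold ptrOf
  split_ifs <;> exact ⟨_, rfl⟩

@[simp] theorem ptrOf_inj {t : S.Thread} {p q : S.PVar} : ptrOf t p = ptrOf t q ↔ p = q := by
  refine ⟨fun h => ?_, fun h => h ▸ rfl⟩
  unfold ptrOf at h
  split_ifs at h <;> simp_all

theorem ptrOf_ne_of_notMem_shared {t t' : S.Thread} {p : S.PVar} (hp : p ∉ S.shared)
    (ht : t ≠ t') (q : S.PVar) : ptrOf t p ≠ ptrOf t' q := by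
  unfold ptrOf
  split_ifs <;> simp_all

/-! ### Pointer values after the individual updates. -/

section Memory

variable (τ : Comp S) (t : S.Thread) (c : Com S)

open Classical in
theorem Comp.mem_ptr_run_ptr (e e' : PExp S) (v : PVal S) :
    (τ.snoc (.run t c [.ptr e v])).mem.ptr e' = if e' = e then some v else τ.mem.ptr e' := by
  simp [Comp.mem, Mem.apply, Function.update_apply]

@[simp] theorem Comp.mem_ptr_run_dat (e : DExp S) (e' : PExp S) (d : S.Dom) :
    (τ.snoc (.run t c [.dat e d])).mem.ptr e' = τ.mem.ptr e' := by
  simp [Comp.mem, Mem.apply]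

@[simp] theorem Comp.mem_run_nil : (τ.snoc (.run t c [])).mem = τ.mem := rfl

open Classical in
theorem Comp.mem_ptr_malloc (e e' : PExp S) (a : S.Adr) (d : S.Dom) :
    (τ.snoc (.run t c [.ptr e (.adr a), .ptr (.sel a) .seg, .dat (.sel a) d])).mem.ptr e' =
      if e' = .sel a then some .seg else if e' = e then some (.adr a) else τ.mem.ptr e' := by
  simp [Comp.mem, Mem.apply, Function.update_apply]

end Memory

theorem Comp.fresh_malloc (τ : Comp S) (t : S.Thread) (p : S.PVar) (a : S.Adr) (d : S.Dom) :
    (τ.snoc (.run t (.malloc p)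
      [.ptr (ptrOf t p) (.adr a), .ptr (.sel a) .seg, .dat (.sel a) d])).fresh =
      τ.fresh \ {a} := by
  ext b
  simp [Comp.fresh, Comp.mem_ptr_malloc, eq_comm]

theorem Comp.freed_malloc (τ : Comp S) (t : S.Thread) (p : S.PVar) (a : S.Adr) (d : S.Dom) :
    (τ.snoc (.run t (.malloc p)
      [.ptr (ptrOf t p) (.adr a), .ptr (.sel a) .seg, .dat (.sel a) d])).freed =
      τ.freed \ {a} := by
  ext b
  simp [Comp.freed, Comp.mem_ptr_malloc, eq_comm]

theorem Comp.notMem_freed_of_mem_fresh {τ : Comp S} {a : S.Adr} (h : a ∈ τ.fresh) :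
    a ∉ τ.freed := by
  induction τ with
  | nil => simp [Comp.freed]
  | snoc τ act ih =>
    cases act with
    | free b => exact fun h' => h'.elim (ih h.1) h.2
    | run t c up =>
      cases c
      case malloc p => exact fun h' => ih h.1 h'.1
      all_goals exact ih h

theorem Comp.fresh_run_subset (τ : Comp S) (t : S.Thread) (c : Com S) (up : List (Upd S)) :
    (τ.snoc (.run t c up)).fresh ⊆ τ.fresh := by
  cases c
  case malloc p => exact Set.sdiff_subset
  all_goals exact subset_rfl

theorem Comp.freed_run_subset (τ : Comp S) (t : S.Thread) (c : Com S) (up : List (Upd S)) :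
    (τ.snoc (.run t c up)).freed ⊆ τ.freed := by
  cases c
  case malloc p => exact Set.sdiff_subset
  all_goals exact subset_rfl

/-- Variables have values, and addresses that occur in the memory or have been retired are not
fresh. -/
structure Comp.WF (τ : Comp S) : Prop where
  ptr_var : ∀ x, τ.mem.ptr (.var x) ≠ none
  dat_var : ∀ t u, τ.mem.dat (.var t u) ≠ none
  ptr_notMem_fresh : ∀ e a, τ.mem.ptr e = some (.adr a) → a ∉ τ.fresh
  retired_notMem_fresh : ∀ a ∈ τ.retired, a ∉ τ.fresh

theorem Comp.WF.ptr_ptrOf {τ : Comp S} (h : τ.WF) (t : S.Thread) (p : S.PVar) :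
    τ.mem.ptr (ptrOf t p) ≠ none := by
  obtain ⟨x, hx⟩ := ptrOf_eq_var t p
  exact hx ▸ h.ptr_var x

/-- The values after a command without reallocation are old values or fresh addresses. -/
theorem Enabled.ptr_run {X : Set S.Adr} {τ : Comp S} {t : S.Thread} {c : Com S} {up : List (Upd S)}
    (h : Enabled X ∅ τ (.run t c up)) {e : PExp S} {a : S.Adr}
    (he : (τ.snoc (.run t c up)).mem.ptr e = some (.adr a)) :
    τ.mem.ptr e = some (.adr a) ∨
      (∃ q, τ.mem.ptr (ptrOf t q) = some (.adr a) ∧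
        ((∃ p, c = .assign p q) ∨ ∃ p, c = .store p q)) ∨
      (∃ b, τ.mem.ptr (.sel b) = some (.adr a)) ∨
      a ∈ τ.fresh ∧ a ∉ (τ.snoc (.run t c up)).fresh := by
  cases h
  case assign p q v hv =>
    rw [Comp.mem_ptr_run_ptr] at he
    split_ifs at he
    · exact .inr (.inl ⟨q, hv.trans he, .inl ⟨p, rfl⟩⟩)
    · exact .inl he
  case load p q b v hv hb =>
    rw [Comp.mem_ptr_run_ptr] at he
    split_ifs at he
    · exact .inr (.inr (.inl ⟨b, hv.trans he⟩))
    · exact .inl he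
  case store p q b v hb hv =>
    rw [Comp.mem_ptr_run_ptr] at he
    split_ifs at he
    · exact .inr (.inl ⟨q, hv.trans he, .inr ⟨p, rfl⟩⟩)
    · exact .inl he
  case malloc p b d hb =>
    rw [Comp.mem_ptr_malloc] at he
    split_ifs at he
    · cases he
    · cases he
      refine .inr (.inr (.inr ⟨by simpa using hb, ?_⟩))
      rw [Comp.fresh_malloc]
      simp
    · exact .inl he
  all_goals exact .inl (by simpa using he)

theorem Comp.ptr_run_ne_none (τ : Comp S) (e : PExp S) (act : Act S) (he : τ.mem.ptr e ≠ none) :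
    (τ.snoc act).mem.ptr e ≠ none := by
  cases act with
  | free a => exact he
  | run t c up =>
    simp only [Comp.mem]
    generalize τ.mem = m at he
    induction up generalizing m with
    | nil => exact he
    | cons u up ih =>
      refine ih _ ?_
      cases u
      · simp only [Mem.apply, Function.update_apply]
        split_ifs
        · simp
        · exact he
      · exact he

theorem Comp.dat_run_ne_none (τ : Comp S) (e : DExp S) (act : Act S) (he : τ.mem.dat e ≠ none) :
    (τ.snoc act).mem.dat e ≠ none := by
  cases act with
  | free a => exact he
  | run t c up =>
    simp only [Comp.mem]
    generalize τ.mem = m at he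
    induction up generalizing m with
    | nil => exact he
    | cons u up ih =>
      refine ih _ ?_
      cases u
      · exact he
      · simp only [Mem.apply, Function.update_apply]
        split_ifs
        · simp
        · exact he

theorem Comp.mem_retired_run {τ : Comp S} {t : S.Thread} {c : Com S} {up : List (Upd S)}
    {a : S.Adr} (h : a ∈ (τ.snoc (.run t c up)).retired) :
    a ∈ τ.retired ∨ ∃ e, τ.mem.ptr e = some (.adr a) := by
  cases c
  case enter f ps us =>
    simp only [Comp.retired] at h
    split_ifs at h
    · exact h.imp id fun ⟨i, hi⟩ => ⟨_, hi⟩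
    · exact .inl h
  all_goals exact .inl h

/-- Commands only copy pointer values or introduce the address they allocate, and an address that
has left the fresh set never returns to it. -/
theorem Liberal.wf {P : Stmt S} {X : Set S.Adr} {τ : Comp S} (h : Liberal P X ∅ τ) : τ.WF := by
  induction h with
  | nil =>
    refine ⟨fun x => by simp [Comp.mem, Mem.initial], fun t u => by simp [Comp.mem, Mem.initial],
      fun e a he => ?_, by simp [Comp.retired]⟩
    cases e <;> simp [Comp.mem, Mem.initial] at he
  | @snoc τ act _ _ hen ih =>
    refine ⟨fun x => τ.ptr_run_ne_none _ _ (ih.ptr_var x),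
      fun t u => τ.dat_run_ne_none _ _ (ih.dat_var t u), fun e a he => ?_, fun a ha => ?_⟩
    · cases act with
      | free b => exact fun h => ih.ptr_notMem_fresh e a he h.1
      | run t c up =>
        have hs := τ.fresh_run_subset t c up
        obtain h | ⟨q, h, -⟩ | ⟨b, h⟩ | ⟨-, h⟩ := hen.ptr_run he
        · exact fun h' => ih.ptr_notMem_fresh _ a h (hs h')
        · exact fun h' => ih.ptr_notMem_fresh _ a h (hs h')
        · exact fun h' => ih.ptr_notMem_fresh _ a h (hs h')
        · exact h
    · cases act with
      | free b => exact fun h => ih.retired_notMem_fresh a ha.1 h.1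
      | run t c up =>
        have hs := τ.fresh_run_subset t c up
        obtain h | ⟨e, h⟩ := Comp.mem_retired_run ha
        · exact fun h' => ih.retired_notMem_fresh a h (hs h')
        · exact fun h' => ih.ptr_notMem_fresh _ a h (hs h')

/-- Variables are never undefined and enabledness excludes `seg`, so all arguments are addresses; a
call therefore always shows up in the history. -/
theorem Enabled.exists_event {X Y : Set S.Adr} {τ : Comp S} (hwf : τ.WF) {t : S.Thread} {f : S.Fn}
    {ps : Fin (S.nPtr f) → S.PVar} {us : Fin (S.nDat f) → S.DVar} {up : List (Upd S)}
    (h : Enabled X Y τ (.run t (.enter f ps us) up)) :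
    ∃ e, (Com.enter f ps us).event t τ.mem = some e := by
  cases h with
  | enter h =>
    have h₁ : ∀ i, ∃ a, τ.mem.ptr (ptrOf t (ps i)) = some (.adr a) := by
      intro i
      rcases hv : τ.mem.ptr (ptrOf t (ps i)) with _ | _ | a
      · exact absurd hv (hwf.ptr_ptrOf t _)
      · exact absurd hv (h i)
      · exact ⟨a, rfl⟩
    have h₂ : ∀ j, ∃ d, τ.mem.dat (.var t (us j)) = some d :=
      fun j => Option.ne_none_iff_exists'.1 (hwf.dat_var t _)
    choose as has using h₁
    choose ds hds using h₂
    have hx : ∃ x : (Fin (S.nPtr f) → S.Adr) × (Fin (S.nDat f) → S.Dom),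
        (∀ i, τ.mem.ptr (ptrOf t (ps i)) = some (.adr (x.1 i))) ∧
        (∀ j, τ.mem.dat (.var t (us j)) = some (x.2 j)) := ⟨(as, ds), has, hds⟩
    simp only [Com.event, dif_pos hx]
    exact ⟨_, rfl⟩

/-! ## Elision of frees -/

/-- The computation without its frees. -/
def Comp.eraseFrees : Comp S → Comp S
  | .nil => .nil
  | .snoc τ (.free _) => τ.eraseFrees
  | .snoc τ (.run t c up) => τ.eraseFrees.snoc (.run t c up)

@[simp] theorem Comp.mem_eraseFrees (τ : Comp S) : τ.eraseFrees.mem = τ.mem := by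
  induction τ with
  | nil => rfl
  | snoc τ act ih =>
    cases act with
    | free a => exact ih
    | run t c up => simp [Comp.eraseFrees, Comp.mem, ih]

@[simp] theorem Comp.lockset_eraseFrees (τ : Comp S) : τ.eraseFrees.lockset = τ.lockset := by
  induction τ with
  | nil => rfl
  | snoc τ act ih =>
    cases act with
    | free a => exact ih
    | run t c up => cases c <;> simp [Comp.eraseFrees, Comp.lockset, ih]

theorem Comp.mem_snoc_eraseFrees (τ : Comp S) (t : S.Thread) (c : Com S) (up : List (Upd S)) :
    (τ.eraseFrees.snoc (.run t c up)).mem = (τ.snoc (.run t c up)).mem :=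
  (τ.snoc (.run t c up)).mem_eraseFrees

theorem Comp.fresh_subset_fresh_eraseFrees (τ : Comp S) : τ.fresh ⊆ τ.eraseFrees.fresh := by
  induction τ with
  | nil => exact subset_rfl
  | snoc τ act ih =>
    cases act with
    | free a => exact Set.sdiff_subset.trans ih
    | run t c up =>
      cases c
      case malloc p =>
        simp only [Comp.eraseFrees, Comp.fresh, Comp.mem_snoc_eraseFrees]
        exact Set.sdiff_subset_sdiff_left ih
      all_goals exact ih

@[simp] theorem Comp.freed_eraseFrees (τ : Comp S) : τ.eraseFrees.freed = ∅ := by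
  induction τ with
  | nil => rfl
  | snoc τ act ih =>
    cases act with
    | free a => exact ih
    | run t c up => cases c <;> simp [Comp.eraseFrees, Comp.freed, ih]

theorem Control.eraseFrees {P : Stmt S} {pc : S.Thread → Stmt S} {τ : Comp S}
    (h : Control P pc τ) : Control P pc τ.eraseFrees := by
  induction h with
  | start => exact .start
  | insideSilent _ hs hl ih => exact .insideSilent ih hs (by simpa using hl)
  | insideCom up _ hs hl ih => exact .insideCom up ih hs (by simpa using hl)
  | outsideSilent _ hs hl ih => exact .outsideSilent ih hs (by simpa using hl)
  | acquire up _ hs hl hl' ih =>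
    refine .acquire up ih hs (by simpa using hl) ?_
    rw [← hl']
    exact Comp.lockset_eraseFrees (Comp.snoc _ (.run _ _ up))
  | free a _ _ ih => exact ih

/-- Apart from allocation, thread actions depend on the memory alone. Allocation must pick a fresh
address since reallocation is forbidden, and dropping frees only enlarges the fresh set. -/
theorem Enabled.eraseFrees {X : Set S.Adr} {τ : Comp S} {t : S.Thread} {c : Com S}
    {up : List (Upd S)} (h : Enabled X ∅ τ (.run t c up)) :
    Enabled ∅ ∅ τ.eraseFrees (.run t c up) := by
  have hm := τ.mem_eraseFrees
  cases h
  case malloc p a d ha =>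
    exact .malloc d (.inl (τ.fresh_subset_fresh_eraseFrees (by simpa using ha)))
  all_goals constructor
  all_goals first
    | (rw [hm]; assumption)
    | assumption

theorem Liberal.eraseFrees {P : Stmt S} {X : Set S.Adr} {τ : Comp S} (h : Liberal P X ∅ τ) :
    Liberal P ∅ ∅ τ.eraseFrees := by
  induction h with
  | nil => exact .nil
  | @snoc τ act _ hc hen ih =>
    cases act with
    | free a => exact ih
    | run t c up =>
      obtain ⟨pc, hc⟩ := hc
      exact .snoc ih ⟨pc, hc.eraseFrees⟩ hen.eraseFrees

/-! ### Transfer of activity and annotations from the garbage-collected semantics. -/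

section Active

variable {B : Automaton S V} (hO : (smrAut B).Complete) (hA : (smrAut B).AcceptsByFree)
  (t₀ : S.Thread) {P : Stmt S} {X : Set S.Adr}

include hO hA t₀

/-- A free moves its address from retired to freed, leaving the union unchanged because the address
had to be retired. Allocation returns a fresh, hence never freed, address and so takes nothing out
of the freed set. -/
theorem Liberal.retired_eraseFrees {τ : Comp S} (h : Liberal P X ∅ τ)
    (hs : τ.history ∈ (smrAut B).spec) : τ.eraseFrees.retired = τ.freed ∪ τ.retired := by
  induction h with
  | nil => simp [Comp.eraseFrees, Comp.retired, Comp.freed]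
  | @snoc τ act _ hc hen ih =>
    have hs' := mem_spec_of_snoc hO hA hs
    replace ih := ih hs'
    cases act with
    | free a =>
      have ha := mem_retired_of_free_mem_spec hO t₀ hs hs'
      simp only [Comp.eraseFrees, Comp.retired, Comp.freed, ih]
      ext b
      by_cases hb : b = a <;> simp_all
    | run t c up =>
      cases hen
      case malloc p a d ha =>
        have ha : a ∉ τ.freed := Comp.notMem_freed_of_mem_fresh (by simpa using ha)
        rw [Comp.freed_malloc, Set.sdiff_singleton_eq_self ha]
        exact ih
      case enter f ps us hps =>
        simp only [Comp.eraseFrees, Comp.retired, Comp.freed, Comp.mem_eraseFrees]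
        split_ifs
        · rw [ih, Set.union_assoc]
        · exact ih
      all_goals exact ih

theorem Liberal.active_eraseFrees {τ : Comp S} (h : Liberal P X ∅ τ)
    (hs : τ.history ∈ (smrAut B).spec) : τ.eraseFrees.active = τ.active := by
  simp [Comp.active, h.retired_eraseFrees hO hA t₀ hs]

/-- Annotations refer only to pointer values, active addresses and the choices for angels, none of
which notice the elision. -/
theorem Liberal.sat_eraseFrees {τ : Comp S} (h : Liberal P X ∅ τ)
    (hs : τ.history ∈ (smrAut B).spec) : τ.eraseFrees.Sat = τ.Sat := by
  induction h with
  | nil => rfl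
  | @snoc τ act hl hc hen ih =>
    have hs' := mem_spec_of_snoc hO hA hs
    have ha := hl.active_eraseFrees hO hA t₀ hs'
    replace ih := ih hs'
    cases act with
    | free a => exact ih
    | run t c up =>
      cases c
      case inv i => cases i <;> simp only [Comp.eraseFrees, Comp.Sat, ih, ha, Comp.mem_eraseFrees]
      all_goals exact ih

theorem Liberal.invHolds {τ : Comp S} (h : Liberal P X ∅ τ) (hs : τ.history ∈ (smrAut B).spec)
    (hinv : ∀ τ ∈ sem P ∅ ∅, τ.InvHolds) : τ.InvHolds := by
  have := hinv _ h.eraseFrees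
  rwa [Comp.InvHolds, h.sat_eraseFrees hO hA t₀ hs] at this

end Active

variable {B : Automaton S V}

/-! ## Types of addresses -/

theorem tyLocs_empty : tyLocs (∅ : Ty B) = Set.univ := by simp [tyLocs]

theorem tyLocs_anti {T T' : Ty B} (h : T' ⊆ T) : tyLocs T ⊆ tyLocs T' :=
  fun _ hl g hg => hl g (h hg)

theorem IsValid.mono {T T' : Ty B} (h : T' ⊆ T) (hT : IsValid T') : IsValid T :=
  hT.imp (@h _) (Or.imp (@h _) (@h _))

theorem not_isValid_empty : ¬ IsValid (∅ : Ty B) := by simp [IsValid]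

theorem isValid_union {T T' : Ty B} : IsValid (T ∪ T') ↔ IsValid T ∨ IsValid T' := by
  simp only [IsValid, Set.mem_union]
  tauto

/-- When the automaton tracks `t` and `a`, the history of `τ` leads to locations of the type `T`
only, and `a` has not been freed if `T` is valid. -/
structure Comp.HasTy (τ : Comp S) (t : S.Thread) (a : S.Adr) (T : Ty B) : Prop where
  locs : ∀ φ : Valuation S V, φ.thr V.zt = t → φ.adr V.za = a →
    ∀ l, (smrAut B).Run φ (smrAut B).initial τ.history l → l ∈ tyLocs T
  notMem_freed : IsValid T → a ∉ τ.freed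

namespace Comp.HasTy

variable {τ : Comp S} {t : S.Thread} {a : S.Adr} {T T' : Ty B}

theorem empty : τ.HasTy t a (∅ : Ty B) :=
  ⟨fun _ _ _ _ _ => by simp [tyLocs_empty], fun h => absurd h not_isValid_empty⟩

theorem mono (h : τ.HasTy t a T) (hT : T' ⊆ T) : τ.HasTy t a T' :=
  ⟨fun φ ht ha l hr => tyLocs_anti hT (h.locs φ ht ha l hr), fun hv => h.notMem_freed (hv.mono hT)⟩

theorem union (h : τ.HasTy t a T) (h' : τ.HasTy t a T') : τ.HasTy t a (T ∪ T') :=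
  ⟨fun φ ht ha l hr g hg => hg.elim (h.locs φ ht ha l hr g) (h'.locs φ ht ha l hr g),
    fun hv => (isValid_union.1 hv).elim h.notMem_freed h'.notMem_freed⟩

/-- The validity clause of `TransformsTy` is what carries the absence of frees: locations cannot,
since retiring and then freeing the tracked address brings the base automaton back to `init`. -/
theorem transforms_id (h : τ.HasTy t a T) (hT : TransformsTy id T T') : τ.HasTy t a T' :=
  ⟨fun φ ht ha l hr => hT.1 (h.locs φ ht ha l hr), fun hv => h.notMem_freed (hT.2.1 hv)⟩

theorem run_none (h : τ.HasTy t a T) {t' : S.Thread} {c : Com S} {up : List (Upd S)}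
    (he : c.event t' τ.mem = none) : (τ.snoc (.run t' c up)).HasTy t a T :=
  ⟨fun φ ht ha l hr => h.locs φ ht ha l (by rwa [Comp.history_run_none he] at hr),
    fun hv hf => h.notMem_freed hv (τ.freed_run_subset _ _ _ hf)⟩

/-- The source of 𝕃 at allocations and of 𝔸 at activity annotations. -/
theorem of_init {G : Guarantee B} (hG : G.locs = {l | l.1 = BaseLoc.init})
    (hs : τ.history ∈ (smrAut B).spec) (hf : a ∉ τ.freed) (hr : a ∉ τ.retired) :
    τ.HasTy t a {G} := by
  refine ⟨?_, fun _ => hf⟩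
  rintro φ - rfl l hl _ rfl
  rw [hG]
  exact fst_eq_init_of_notMem_retired hs hl hr

/-- Types without transient or local guarantees are preserved by steps of other threads. -/
theorem interference_run (h : τ.HasTy t a T) (hact : Guarantee.act ∉ T) {t' : S.Thread} {c : Com S}
    {up : List (Upd S)} (htt : t' ≠ t)
    (hloc : Guarantee.loc ∈ T → ∀ q, τ.mem.ptr (ptrOf t' q) ≠ some (.adr a))
    (hs : (τ.snoc (.run t' c up)).history ∈ (smrAut B).spec) :
    (τ.snoc (.run t' c up)).HasTy t a T := by
  cases he : c.event t' τ.mem with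
  | none => exact h.run_none he
  | some e =>
    refine ⟨?_, fun hv hf => h.notMem_freed hv (τ.freed_run_subset _ _ _ hf)⟩
    rintro φ ht ha l hr g hg
    have hfin := fst_ne_final_of_mem_spec hs hr
    rw [Comp.history_run_some he] at hr
    obtain ⟨l₁, hr₁, hst⟩ := (smrAut B).run_append_singleton.1 hr
    have hl₁ := h.locs φ ht ha l₁ hr₁ g hg
    have hth : e.thread ≠ some (φ.thr V.zt) := by
      rw [Com.thread_event he, ht]
      simpa using htt
    cases g with
    | act => exact absurd hg hact
    | safe => exact (smrAut B).closed_safeLoc φ l₁ e l hst hl₁ hth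
    | custom L hL => exact hL φ l₁ e l hst hl₁ hth
    | loc =>
      have hb := baseAut_step_of_smrAut_step hst
      rw [show l₁.1 = BaseLoc.init from hl₁] at hb
      -- With `final` excluded by the specification, `init` can only be left by retiring `a`, and
      -- `t'` has no pointer to pass `a` with.
      obtain hb | hb | ⟨_, _, _, rfl, i, hi⟩ := baseAut_step_init hb
      · exact hb
      · exact absurd hb hfin
      · obtain ⟨f, ps, us, as, ds, rfl, he', hm⟩ | ⟨f, -, he'⟩ := Com.event_eq_some he
        · cases he'
          exact absurd ((hm i).trans (by rw [hi, ha])) (hloc hg _)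
        · cases he'

/-- Types without transient guarantees are preserved by frees. -/
theorem free (hO : (smrAut B).Complete) (h : τ.HasTy t a T) (hact : Guarantee.act ∉ T) {b : S.Adr}
    (hs : (τ.snoc (.free b)).history ∈ (smrAut B).spec) : (τ.snoc (.free b)).HasTy t a T := by
  constructor
  · rintro φ ht ha l hr g hg
    have hfin := fst_ne_final_of_mem_spec hs hr
    obtain ⟨l₁, hr₁, hst⟩ := (smrAut B).run_append_singleton.1 hr
    have hl₁ := h.locs φ ht ha l₁ hr₁ g hg
    have hth : (Event.free b : Event S).thread ≠ some (φ.thr V.zt) := by simp [Event.thread]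
    cases g with
    | act => exact absurd hg hact
    | safe => exact (smrAut B).closed_safeLoc φ l₁ _ l hst hl₁ hth
    | custom L hL => exact hL φ l₁ _ l hst hl₁ hth
    | loc =>
      have hb := baseAut_step_of_smrAut_step hst
      rw [show l₁.1 = BaseLoc.init from hl₁] at hb
      obtain hb | hb | ⟨_, _, _, he, _⟩ := baseAut_step_init hb
      · exact hb
      · exact absurd hb hfin
      · cases he
  · rintro hv (hf | rfl)
    · exact h.notMem_freed hv hf
    -- The freed address is `a` itself: whichever guarantee makes `T` valid, a run tracking `a`
    -- becomes accepting, contrary to the specification.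
    · obtain ⟨l, hl⟩ := hO.exists_run (Valuation.track V t a) (smrAut B).initial τ.history
      obtain ⟨l', hl'⟩ := hO (Valuation.track V t a) l (.free a)
      have hr := (smrAut B).run_append_singleton.2 ⟨l, hl, hl'⟩
      have hT := h.locs _ rfl rfl l hl
      obtain hv | hv | hv := hv
      · have hb := baseAut_step_of_smrAut_step hl'
        rw [show l.1 = BaseLoc.init from hT _ hv] at hb
        exact fst_ne_final_of_mem_spec hs hr (baseAut_step_init_free hb)
      · exact hact hv
      · exact hs _ l' hr
          ((smrAut B).mem_accepting_of_mem_safeLoc (φ := Valuation.track V t a) (hT _ hv) hl')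

end Comp.HasTy

/-! ## The invariant of a thread -/

/-- `Γ` describes the pointers and angels of thread `t` after `τ`. -/
structure ThreadInv (τ : Comp S) (t : S.Thread) (Γ : Env B) : Prop where
  hasTy : ∀ x, ∀ a ∈ τ.addresses t x, τ.HasTy t a (Γ x)
  angel : ∀ r, Guarantee.loc ∉ Γ (.inr r)
  unique : ∀ p a, Guarantee.loc ∈ Γ (.inl p) → τ.mem.ptr (ptrOf t p) = some (.adr a) →
    ∀ e, τ.mem.ptr e = some (.adr a) → e = ptrOf t p

/-- `Γ` has no guarantees that can be invalidated by other threads. -/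
structure Env.Stable (Γ : Env B) : Prop where
  act : ∀ x, Guarantee.act ∉ Γ x
  tyLocs_shared : ∀ p ∈ S.shared, tyLocs (Γ (.inl p)) = Set.univ
  not_isValid_shared : ∀ p ∈ S.shared, ¬ IsValid (Γ (.inl p))

theorem TransformsTy.loc_mem {pst : Set (smrAut B).Loc → Set (smrAut B).Loc} {T T' : Ty B}
    (h : TransformsTy pst T T') (hT : Guarantee.loc ∈ T') : Guarantee.loc ∈ T :=
  (h.2.2 ⟨by simp, hT⟩).2

theorem TransformsTy.act_mem {pst : Set (smrAut B).Loc → Set (smrAut B).Loc} {T T' : Ty B}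
    (h : TransformsTy pst T T') (hT : Guarantee.act ∈ T') : Guarantee.act ∈ T :=
  (h.2.2 ⟨by simp, hT⟩).2

theorem TransformsEps.refl (Γ : Env B) : TransformsEps Γ Γ :=
  fun _ => ⟨subset_rfl, id, subset_rfl⟩

theorem TransformsEps.trans {Γ₁ Γ₂ Γ₃ : Env B} (h : TransformsEps Γ₁ Γ₂) (h' : TransformsEps Γ₂ Γ₃) :
    TransformsEps Γ₁ Γ₃ :=
  fun x => ⟨(h x).1.trans (h' x).1, fun hv => (h x).2.1 ((h' x).2.1 hv),
    (h' x).2.2.trans (h x).2.2⟩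

theorem ThreadInv.transformsEps {τ : Comp S} {t : S.Thread} {Γ Γ' : Env B} (h : ThreadInv τ t Γ)
    (hΓ : TransformsEps Γ Γ') : ThreadInv τ t Γ' where
  hasTy x a ha := (h.hasTy x a ha).transforms_id (hΓ x)
  angel r hr := h.angel r ((hΓ _).loc_mem hr)
  unique p a hp := h.unique p a ((hΓ _).loc_mem hp)

/-- Stability of shared pointers speaks of location sets instead of empty types for the sake of this
lemma: the consequence rule may replace the empty type by an `𝔼_L` with `L` the set of all
locations. -/
theorem Env.Stable.transformsEps {Γ Γ' : Env B} (h : Γ.Stable) (hΓ : TransformsEps Γ Γ') :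
    Γ'.Stable where
  act x hx := h.act x ((hΓ x).act_mem hx)
  tyLocs_shared p hp := Set.univ_subset_iff.1 (h.tyLocs_shared p hp ▸ (hΓ _).1)
  not_isValid_shared p hp hv := h.not_isValid_shared p hp ((hΓ _).2.1 hv)

theorem Env.stable_initial : (Env.initial B).Stable where
  act _ := id
  tyLocs_shared _ _ := tyLocs_empty
  not_isValid_shared _ _ := not_isValid_empty

theorem Env.stable_rmTransient (Γ : Env B) : (rmTransient Γ).Stable where
  act x := by
    cases x
    · simp only [rmTransient]
      split_ifs <;> simp
    · simp [rmTransient]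
  tyLocs_shared p hp := by simp [rmTransient, hp, tyLocs_empty]
  not_isValid_shared p hp := by simp [rmTransient, hp, not_isValid_empty]

/-- An annotation other than `angel` can only rule out choices made earlier, and an angel allocation
changes no entry but its own. -/
theorem Comp.denotation_run_subset (τ : Comp S) (t' : S.Thread) (c : Com S) (up : List (Upd S))
    (t : S.Thread) (r : S.AVar) (h : t' = t → c ≠ .inv (.angel r)) :
    (τ.snoc (.run t' c up)).denotation t r ⊆ τ.denotation t r := by
  rintro a ⟨ρ, hρ, ha⟩
  cases c
  case inv i =>
    cases i
    case angel r' =>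
      obtain ⟨ρ₀, A, h₀, rfl⟩ := hρ
      refine ⟨ρ₀, h₀, ?_⟩
      by_cases ht : t = t'
      · subst ht
        have : r ≠ r' := fun hr => h rfl (by rw [hr])
        simpa [Function.update_apply, this] using ha
      · simpa [Function.update_apply, ht] using ha
    all_goals exact ⟨ρ, hρ.1, ha⟩
  all_goals exact ⟨ρ, hρ, ha⟩

theorem Enabled.ptr_other {X Y : Set S.Adr} {τ : Comp S} {t' : S.Thread} {c : Com S}
    {up : List (Upd S)} (h : Enabled X Y τ (.run t' c up)) {t : S.Thread} {p : S.PVar}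
    (hp : ∀ q, ptrOf t p ≠ ptrOf t' q) :
    (τ.snoc (.run t' c up)).mem.ptr (ptrOf t p) = τ.mem.ptr (ptrOf t p) := by
  cases h <;> simp [Comp.mem_ptr_run_ptr, Comp.mem_ptr_malloc, hp]

/-- Steps of other threads preserve the invariant of a thread outside of atomic blocks. -/
theorem ThreadInv.interference_run {X : Set S.Adr} {τ : Comp S} {t t' : S.Thread} {Γ : Env B}
    {c : Com S} {up : List (Upd S)} (h : ThreadInv τ t Γ) (hΓ : Γ.Stable) (htt : t' ≠ t)
    (hwf : τ.WF) (hen : Enabled X ∅ τ (.run t' c up))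
    (hs : (τ.snoc (.run t' c up)).history ∈ (smrAut B).spec) :
    ThreadInv (τ.snoc (.run t' c up)) t Γ where
  hasTy x a ha := by
    cases x with
    | inl p =>
      by_cases hp : p ∈ S.shared
      · exact ⟨fun _ _ _ _ _ => by simp [hΓ.tyLocs_shared p hp],
          fun hv => absurd hv (hΓ.not_isValid_shared p hp)⟩
      · have hne := ptrOf_ne_of_notMem_shared hp htt.symm
        change _ = _ at ha
        rw [hen.ptr_other hne] at ha
        exact (h.hasTy (.inl p) a ha).interference_run (hΓ.act _) htt
          (fun hl q hq => hne q (h.unique p a hl ha _ hq).symm) hs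
    | inr r =>
      have ha := τ.denotation_run_subset t' c up t r (absurd · htt) ha
      exact (h.hasTy (.inr r) a ha).interference_run (hΓ.act _) htt (fun hl => absurd hl (h.angel r)) hs
  angel := h.angel
  unique p a hl ha e he := by
    have hp : p ∉ S.shared := fun hp => hΓ.not_isValid_shared p hp (.inl hl)
    have hne := ptrOf_ne_of_notMem_shared hp htt.symm
    rw [hen.ptr_other hne] at ha
    -- A new copy of `a` would come from a variable accessed by `t'`, from a selector, or from
    -- allocation. The first two would be second references to `a` before the step, and an address
    -- in memory is not fresh.
    obtain he | ⟨q, he, -⟩ | ⟨b, he⟩ | ⟨he, -⟩ := hen.ptr_run he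
    · exact h.unique p a hl ha e he
    · exact absurd (h.unique p a hl ha _ he).symm (hne q)
    · exact absurd (h.unique p a hl ha _ he) (by simp)
    · exact absurd he (hwf.ptr_notMem_fresh _ a ha)

/-- Frees preserve the invariant of a thread outside of atomic blocks. -/
theorem ThreadInv.free (hO : (smrAut B).Complete) {τ : Comp S} {t : S.Thread} {Γ : Env B}
    (h : ThreadInv τ t Γ) (hΓ : Γ.Stable) {b : S.Adr}
    (hs : (τ.snoc (.free b)).history ∈ (smrAut B).spec) : ThreadInv (τ.snoc (.free b)) t Γ where
  hasTy x a ha := by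
    refine (h.hasTy x a ?_).free hO (hΓ.act x) hs
    cases x <;> exact ha
  angel := h.angel
  unique := h.unique

/-! ## Static changes of the type environment -/

theorem ThreadInv.mono {τ : Comp S} {t : S.Thread} {Γ Γ' : Env B} (h : ThreadInv τ t Γ)
    (hΓ : ∀ x, Γ' x ⊆ Γ x) : ThreadInv τ t Γ' where
  hasTy x a ha := (h.hasTy x a ha).mono (hΓ x)
  angel r hr := h.angel r (hΓ _ hr)
  unique p a hp := h.unique p a (hΓ _ hp)

open Classical in
-- The side condition confines 𝕃 to pointers, and only to those that hold the sole reference.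
theorem ThreadInv.add {τ : Comp S} {t : S.Thread} {Γ : Env B} (h : ThreadInv τ t Γ)
    {x : S.PVar ⊕ S.AVar} {T : Ty B} (hT : ∀ a ∈ τ.addresses t x, τ.HasTy t a T)
    (hloc : Guarantee.loc ∈ T → ∃ p, x = .inl p ∧ ∀ a, τ.mem.ptr (ptrOf t p) = some (.adr a) →
      ∀ e, τ.mem.ptr e = some (.adr a) → e = ptrOf t p) :
    ThreadInv τ t (Function.update Γ x (Γ x ∪ T)) where
  hasTy y a ha := by
    by_cases hy : y = x
    · subst hy
      simpa using (h.hasTy y a ha).union (hT a ha)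
    · simpa [Function.update_of_ne hy] using h.hasTy y a ha
  angel r hr := by
    by_cases hy : Sum.inr r = x
    · subst hy
      obtain hr | hr : _ ∨ _ := by simpa using hr
      · exact h.angel r hr
      · obtain ⟨p, hp, -⟩ := hloc hr
        cases hp
    · exact h.angel r (by simpa [Function.update_of_ne hy] using hr)
  unique p a hp := by
    by_cases hy : Sum.inl p = x
    · subst hy
      obtain hp | hp : _ ∨ _ := by simpa using hp
      · exact h.unique p a hp
      · obtain ⟨p', hp', hu⟩ := hloc hp
        cases hp'
        exact hu a
    · exact h.unique p a (by simpa [Function.update_of_ne hy] using hp)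

open Classical in
theorem ThreadInv.add_of_ptr_eq {τ : Comp S} {t : S.Thread} {Γ : Env B} (h : ThreadInv τ t Γ)
    {p q : S.PVar} (hpq : τ.mem.ptr (ptrOf t p) = τ.mem.ptr (ptrOf t q)) :
    ThreadInv τ t (Function.update Γ (.inl p) (Γ (.inl p) ∪ Γ (.inl q))) := by
  refine h.add (fun a ha => h.hasTy (.inl q) a (hpq.symm.trans ha)) fun hl => ⟨p, rfl, ?_⟩
  intro a ha e he
  -- Both variables hold `a`, so uniqueness for `q` makes them the same expression.
  have hu := h.unique q a hl (hpq ▸ ha)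
  rw [hu e he, hu _ ha]

open Classical in
theorem ThreadInv.union_of_ptr_eq {τ : Comp S} {t : S.Thread} {Γ : Env B} (h : ThreadInv τ t Γ)
    {p q : S.PVar} (hpq : τ.mem.ptr (ptrOf t p) = τ.mem.ptr (ptrOf t q)) :
    ThreadInv τ t (Function.update (Function.update Γ (.inl p) (Γ (.inl p) ∪ Γ (.inl q)))
      (.inl q) (Γ (.inl p) ∪ Γ (.inl q))) := by
  -- The second application hands the enlarged type of `p` back to `q`.
  refine ((h.add_of_ptr_eq hpq).add_of_ptr_eq hpq.symm).mono fun x => ?_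
  by_cases hx : x = .inl q
  · subst hx
    simp
  · simp [Function.update_of_ne hx]

/-! ## Steps of the thread itself -/

/-- A frame rule. Without an event all runs stay put, so types persist for pointers that keep their
value; overwritten pointers must have been stripped of their type beforehand, and a pointer that is
copied of its 𝕃. The rules for single commands weaken `Γ`, apply this, and then add what the command
establishes. -/
theorem ThreadInv.run_silent {X : Set S.Adr} {τ : Comp S} {t : S.Thread} {Γ : Env B} {c : Com S}
    {up : List (Upd S)} (h : ThreadInv τ t Γ) (hwf : τ.WF) (hen : Enabled X ∅ τ (.run t c up))
    (he : c.event t τ.mem = none) (hc : ∀ r, c ≠ .inv (.angel r))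
    (hp : ∀ p, Γ (.inl p) = ∅ ∨
      (τ.snoc (.run t c up)).mem.ptr (ptrOf t p) = τ.mem.ptr (ptrOf t p))
    (hq : ∀ p q, c = .assign p q ∨ c = .store p q → Guarantee.loc ∉ Γ (.inl q)) :
    ThreadInv (τ.snoc (.run t c up)) t Γ where
  hasTy x a ha := by
    cases x with
    | inl p =>
      obtain hp | hp := hp p
      · rw [hp]
        exact .empty
      · exact (h.hasTy (.inl p) a (hp.symm.trans ha)).run_none he
    | inr r =>
      exact (h.hasTy (.inr r) a
        (τ.denotation_run_subset t c up t r (fun _ => hc r) ha)).run_none he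
  angel := h.angel
  unique p a hl ha e he := by
    obtain hp | hp := hp p
    · simp [hp] at hl
    rw [hp] at ha
    obtain he | ⟨q, he, hcq⟩ | ⟨b, he⟩ | ⟨he, -⟩ := hen.ptr_run he
    · exact h.unique p a hl ha e he
    · obtain rfl : q = p := ptrOf_inj.1 (h.unique p a hl ha _ he)
      obtain ⟨p', hcq⟩ | ⟨p', hcq⟩ := hcq
      · exact absurd hl (hq p' q (.inl hcq))
      · exact absurd hl (hq p' q (.inr hcq))
    · exact absurd (h.unique p a hl ha _ he) (by simp)
    · exact absurd he (hwf.ptr_notMem_fresh _ a ha)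

theorem ThreadInv.run_inv {τ : Comp S} {t : S.Thread} {Γ : Env B} (h : ThreadInv τ t Γ)
    (hwf : τ.WF) {i : Inv S} (hi : ∀ r, i ≠ .angel r) :
    ThreadInv (τ.snoc (.run t (.inv i) [])) t Γ :=
  h.run_silent hwf (.inv (X := ∅)) rfl (by simpa using hi) (fun _ => .inr rfl) (by simp)

theorem ThreadInv.run_event {τ : Comp S} {t : S.Thread} {Γ Γ' : Env B} {c : Com S}
    (h : ThreadInv τ t Γ) {e : Event S} (he : c.event t τ.mem = some e)
    (hΓ : Transforms Γ c Γ') : ThreadInv (τ.snoc (.run t c [])) t Γ' where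
  hasTy x a ha := by
    have ha' : a ∈ τ.addresses t x := by
      cases x with
      | inl p => exact ha
      | inr r =>
        refine τ.denotation_run_subset t c [] t r ?_ ha
        rintro - rfl
        simp [Com.event] at he
    have hx := h.hasTy x a ha'
    refine ⟨?_, fun hv hf => hx.notMem_freed ((hΓ x).2.1 hv) (τ.freed_run_subset _ _ _ hf)⟩
    rintro φ ht rfl l hr
    rw [Comp.history_run_some he] at hr
    obtain ⟨l₁, hr₁, hst⟩ := (smrAut B).run_append_singleton.1 hr
    -- The actual step is an instance of `post`, with the current memory as witness.
    refine (hΓ x).1 ⟨t, τ.mem, φ, e, l₁, hx.locs φ ht rfl l₁ hr₁, he, hst, ht, ?_⟩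
    rintro p rfl
    exact ha'
  angel r hr := h.angel r ((hΓ _).loc_mem hr)
  unique p a hp := h.unique p a ((hΓ _).loc_mem hp)

/-! ### Pointer assignments and allocation by the thread itself. -/

section Com

variable {X : Set S.Adr} {τ : Comp S} {t : S.Thread} {Γ : Env B} {up : List (Upd S)} {p q : S.PVar}
  (h : ThreadInv τ t Γ) (hwf : τ.WF)

include h hwf

open Classical in
theorem ThreadInv.assign (hen : Enabled X ∅ τ (.run t (.assign p q) up)) :
    ThreadInv (τ.snoc (.run t (.assign p q) up)) t
      (Function.update (Function.update Γ (.inl p) (Γ (.inl q) \ {Guarantee.loc}))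
        (.inl q) (Γ (.inl q) \ {Guarantee.loc})) := by
  -- The old type of `p` is lost and `q` stops being unique. After the step both hold the same
  -- value, so the type of `q` can be passed to `p`.
  have h₀ : ThreadInv τ t (Function.update (Function.update Γ (.inl p) ∅) (.inl q)
      (Γ (.inl q) \ {Guarantee.loc})) := by
    refine h.mono fun x => ?_
    simp only [Function.update_apply]
    split_ifs with h₁ h₂
    · exact h₁ ▸ Set.sdiff_subset
    · exact Set.empty_subset _
    · exact subset_rfl
  have hmem : ∀ e, (τ.snoc (.run t (.assign p q) up)).mem.ptr e =
      if e = ptrOf t p then τ.mem.ptr (ptrOf t q) else τ.mem.ptr e := by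
    intro e
    cases hen with
    | assign hv => rw [Comp.mem_ptr_run_ptr, hv]
  have h₁ := h₀.run_silent hwf hen rfl (by simp) (fun p' => by
    by_cases hp : p' = p
    · subst hp
      by_cases hq : p' = q
      · subst hq
        exact .inr (by simp [hmem])
      · exact .inl (by simp [hq])
    · exact .inr (by simp [hmem, hp])) (by
    rintro p' q' (h | h) <;> cases h
    simp)
  refine (h₁.union_of_ptr_eq (p := p) (q := q) (by simp [hmem])).mono fun x => ?_
  simp only [Function.update_apply]
  split_ifs <;> simp_all

open Classical in
theorem ThreadInv.load (hen : Enabled X ∅ τ (.run t (.load p q) up)) :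
    ThreadInv (τ.snoc (.run t (.load p q) up)) t (Function.update Γ (.inl p) ∅) := by
  have h₀ : ThreadInv τ t (Function.update Γ (.inl p) ∅) := by
    refine h.mono fun x => ?_
    simp only [Function.update_apply]
    split_ifs <;> simp
  refine h₀.run_silent hwf hen rfl (by simp) (fun p' => ?_) (by simp)
  by_cases hp : p' = p
  · exact .inl (by simp [hp])
  · cases hen
    exact .inr (by simp [Comp.mem_ptr_run_ptr, hp])

open Classical in
theorem ThreadInv.store (hen : Enabled X ∅ τ (.run t (.store p q) up)) :
    ThreadInv (τ.snoc (.run t (.store p q) up)) t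
      (Function.update Γ (.inl q) (Γ (.inl q) \ {Guarantee.loc})) := by
  have h₀ : ThreadInv τ t (Function.update Γ (.inl q) (Γ (.inl q) \ {Guarantee.loc})) := by
    refine h.mono fun x => ?_
    simp only [Function.update_apply]
    split_ifs with h₁
    · exact h₁ ▸ Set.sdiff_subset
    · exact subset_rfl
  refine h₀.run_silent hwf hen rfl (by simp) (fun p' => ?_) ?_
  · cases hen
    exact .inr (by simp [Comp.mem_ptr_run_ptr])
  · rintro p' q' (h | h) <;> cases h
    simp

open Classical in
-- A fresh address is neither freed nor retired, which gives the location, and occurs nowhere in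
-- memory, which makes the new pointer its only reference.
theorem ThreadInv.malloc (hen : Enabled X ∅ τ (.run t (.malloc p) up))
    (hs : τ.history ∈ (smrAut B).spec) :
    ThreadInv (τ.snoc (.run t (.malloc p) up)) t
      (Function.update Γ (.inl p) {Guarantee.loc}) := by
  have h₀ : ThreadInv τ t (Function.update Γ (.inl p) ∅) := by
    refine h.mono fun x => ?_
    simp only [Function.update_apply]
    split_ifs <;> simp
  have h₁ := h₀.run_silent hwf hen rfl (by simp) (fun p' => by
    by_cases hp : p' = p
    · exact .inl (by simp [hp])
    · cases hen
      exact .inr (by simp [Comp.mem_ptr_malloc, hp])) (by simp)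
  have h₂ := h₁.add (x := .inl p) (T := {Guarantee.loc}) ?_ ?_
  · simpa using h₂
  · intro a ha
    cases hen
    case malloc b d hb =>
      have hb : b ∈ τ.fresh := by simpa using hb
      obtain rfl : a = b := by
        simpa [Comp.addresses, Comp.mem_ptr_malloc] using ha
      exact (Comp.HasTy.of_init rfl hs (Comp.notMem_freed_of_mem_fresh hb)
        (fun hr => hwf.retired_notMem_fresh _ hr hb)).run_none rfl
  · refine fun _ => ⟨p, rfl, fun a ha e he => ?_⟩
    cases hen
    case malloc b d hb =>
      have hb : b ∈ τ.fresh := by simpa using hb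
      rw [Comp.mem_ptr_malloc] at ha he
      obtain rfl : b = a := by simpa using ha
      split_ifs at he with h₁ h₂
      · cases he
      · exact h₂
      · exact absurd hb (hwf.ptr_notMem_fresh _ _ he)

end Com

/-- Type environments of derivable judgements for commands describe the thread after the command. -/
theorem Typed.threadInv_run {X : Set S.Adr} {τ : Comp S} {t : S.Thread} {Γ Γ' : Env B} {c : Com S}
    {up : List (Upd S)} (hty : Typed B Γ (.com c) Γ') (h : ThreadInv τ t Γ) (hwf : τ.WF)
    (hen : Enabled X ∅ τ (.run t c up)) (hs : τ.history ∈ (smrAut B).spec)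
    (hinv : (τ.snoc (.run t c up)).InvHolds) : ThreadInv (τ.snoc (.run t c up)) t Γ' := by
  classical
  generalize hc : Stmt.com c = s at hty
  induction hty with
  | infer hΓ _ hΓ' ih => exact (ih (h.transformsEps hΓ) hc).transformsEps hΓ'
  | assign1 => cases hc; convert h.assign hwf hen
  | assign2 => cases hc; convert h.load hwf hen
  | assign3 => cases hc; convert h.store hwf hen
  | malloc => cases hc; convert h.malloc hwf hen hs
  | assign4 | assign5 | assign6 | beginAtomic =>
    cases hc
    refine h.run_silent hwf hen rfl (by simp) (fun p => .inr ?_) (by simp)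
    cases hen
    simp
  | assume2 =>
    cases hc
    refine h.run_silent hwf hen rfl (by simp) (fun p => .inr ?_) (by simp)
    cases hen <;> simp
  | endAtomic =>
    cases hc
    refine (h.run_silent hwf hen rfl (by simp) (fun p => .inr ?_) (by simp)).mono fun x => ?_
    · cases hen
      simp
    · rcases x with p | r <;> simp only [rmTransient]
      · split_ifs <;> simp
      · exact Set.sdiff_subset
  | @assume1 Γ p q =>
    cases hc
    cases hen
    case assumeEq hpq =>
      refine ((h.run_silent hwf (.assumeEq (X := ∅) hpq) rfl (by simp) (fun p => .inr rfl)
        (by simp)).union_of_ptr_eq hpq).mono fun x => ?_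
      simp only [Function.update_apply]
      split_ifs
      · exact Set.sdiff_subset
      · exact Set.sdiff_subset
      · exact subset_rfl
  | @equal Γ p q =>
    cases hc
    -- The truth of an annotation is a conjunct of `Comp.Sat` for the extended computation; this is
    -- why `hinv` concerns the computation after the step.
    obtain ⟨ρ, -, hpq⟩ := hinv
    cases hen
    convert (h.run_inv hwf (i := (.eq p q)) (by simp)).union_of_ptr_eq hpq
  | @activePtr Γ p =>
    cases hc
    obtain ⟨ρ, -, a, ha, hp⟩ := hinv
    cases hen
    convert (h.run_inv hwf (i := (.activePtr p)) (by simp)).add (x := .inl p) (T := {Guarantee.act}) ?_ (by simp)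
    intro b hb
    cases hp.symm.trans hb
    exact (Comp.HasTy.of_init rfl hs (fun h => ha (.inl h)) (fun h => ha (.inr h))).run_none rfl
  | @activeAngel Γ r =>
    cases hc
    cases hen
    convert (h.run_inv hwf (i := (.activeAngel r)) (by simp)).add (x := .inr r) (T := {Guarantee.act}) ?_ (by simp)
    -- Every choice that survives the annotation satisfies it, so each possibly held address is
    -- active.
    rintro a ⟨ρ, ⟨-, hρ⟩, ha⟩
    have ha := hρ ha
    exact (Comp.HasTy.of_init rfl hs (fun h => ha (.inl h)) (fun h => ha (.inr h))).run_none rfl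
  | @angel Γ r =>
    cases hc
    cases hen
    refine ⟨fun x a ha => ?_, fun r' => ?_, fun p a hp => ?_⟩
    · by_cases hx : x = .inr r
      · subst hx
        simpa using Comp.HasTy.empty
      · rw [Function.update_of_ne hx]
        refine (h.hasTy x a ?_).run_none rfl
        cases x with
        | inl p => exact ha
        | inr r' =>
          refine τ.denotation_run_subset t _ _ t r' (fun _ hr => hx ?_) ha
          cases hr
          rfl
    · simp only [Function.update_apply]
      split_ifs
      · simp
      · exact h.angel r'
    · exact h.unique p a (by simpa using hp)
  | @member Γ p r =>
    cases hc
    obtain ⟨ρ, hρ, a, ha, hp⟩ := hinv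
    cases hen
    convert (h.run_inv hwf (i := (.mem p r)) (by simp)).add (x := .inl p) (T := Γ (.inr r)) ?_ (fun hl => absurd hl (h.angel r))
    intro b hb
    cases hp.symm.trans hb
    -- The choice `ρ` witnesses that the angel possibly holds `a` already before the step, so its
    -- type applies to `a`.
    exact (h.hasTy (.inr r) a ⟨ρ, hρ, ha⟩).run_none rfl
  | enter _ hΓ _ =>
    cases hc
    obtain ⟨e, he⟩ := hen.exists_event hwf
    cases hen
    exact h.run_event he hΓ
  | exit hΓ =>
    cases hc
    cases hen
    exact h.run_event rfl hΓ
  | skip => cases hc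
  | seq => cases hc
  | choice => cases hc
  | loop => cases hc

theorem Typed.stable_endAtomic {Γ Γ' : Env B} (hty : Typed B Γ (.com .endAtomic) Γ') :
    Γ'.Stable := by
  generalize hc : Stmt.com .endAtomic = s at hty
  induction hty with
  | infer _ _ hΓ ih => exact (ih hc).transformsEps hΓ
  | endAtomic => exact Env.stable_rmTransient _
  | _ => cases hc

theorem Typed.isValid_load {Γ Γ' : Env B} {p q : S.PVar}
    (hty : Typed B Γ (.com (.load p q)) Γ') : IsValid (Γ (.inl q)) := by
  generalize hc : Stmt.com (.load p q) = s at hty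
  induction hty with
  | infer hΓ _ _ ih => exact (hΓ _).2.1 (ih hc)
  | assign2 h => cases hc; exact h
  | _ => cases hc

/-! ## Derivations along the control flow -/

theorem Typed.skip_inv {Γ Γ' : Env B} (h : Typed B Γ .skip Γ') : TransformsEps Γ Γ' := by
  generalize hs : Stmt.skip = s at h
  induction h with
  | infer h₁ _ h₂ ih => exact (h₁.trans (ih hs)).trans h₂
  | skip => exact .refl _
  | _ => cases hs

theorem Typed.weaken {Γ Γ₁ Γ₂ : Env B} {s : Stmt S} (h : Typed B Γ s Γ₁)
    (hΓ : TransformsEps Γ₁ Γ₂) : Typed B Γ s Γ₂ :=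
  .infer (.refl _) h hΓ

/-- The environments before and after a control step. -/
def Typed.StepEnv (Γ : Env B) : Option (Com S) → Env B → Prop
  | none, Γ' => TransformsEps Γ Γ'
  | some c, Γ' => Typed B Γ (.com c) Γ'

/-- Subject reduction. Uses of the consequence rule are split: the left half joins the executed
step, the right half the residual derivation. The invariance of `Γ` in the loop rule covers every
unfolding. -/
theorem Typed.step {Γ Γ' : Env B} {s s' : Stmt S} {o : Option (Com S)} (h : Typed B Γ s Γ')
    (hs : s.Step o s') : ∃ Γ₁, StepEnv Γ o Γ₁ ∧ Typed B Γ₁ s' Γ' := by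
  induction h generalizing o s' with
  | infer h₁ _ h₂ ih =>
    obtain ⟨Γ₁, hΓ₁, ht⟩ := ih hs
    refine ⟨Γ₁, ?_, ht.weaken h₂⟩
    cases o with
    | none => exact h₁.trans hΓ₁
    | some c => exact .infer h₁ hΓ₁ (.refl _)
  | skip => cases hs
  | seq h₁ h₂ ih _ =>
    cases hs with
    | seqSkip => exact ⟨_, h₁.skip_inv, h₂⟩
    | seq _ _ hs =>
      obtain ⟨Γ₁, hΓ₁, ht⟩ := ih hs
      exact ⟨Γ₁, hΓ₁, .seq ht h₂⟩
  | choice h₁ h₂ =>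
    cases hs with
    | choiceLeft => exact ⟨_, .refl _, h₁⟩
    | choiceRight => exact ⟨_, .refl _, h₂⟩
  | loop h =>
    cases hs with
    | loopSkip => exact ⟨_, .refl _, .skip⟩
    | loopOnce => exact ⟨_, .refl _, h⟩
    | loopMore => exact ⟨_, .refl _, .seq h (.loop h)⟩
  | assign1 => cases hs; exact ⟨_, .assign1, .skip⟩
  | assign2 h => cases hs; exact ⟨_, .assign2 h, .skip⟩
  | assign3 h => cases hs; exact ⟨_, .assign3 h, .skip⟩
  | assign4 => cases hs; exact ⟨_, .assign4, .skip⟩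
  | assign5 h => cases hs; exact ⟨_, .assign5 h, .skip⟩
  | assign6 h => cases hs; exact ⟨_, .assign6 h, .skip⟩
  | malloc h => cases hs; exact ⟨_, .malloc h, .skip⟩
  | assume1 h h' => cases hs; exact ⟨_, .assume1 h h', .skip⟩
  | assume2 h => cases hs; exact ⟨_, .assume2 h, .skip⟩
  | equal => cases hs; exact ⟨_, .equal, .skip⟩
  | activePtr => cases hs; exact ⟨_, .activePtr, .skip⟩
  | activeAngel => cases hs; exact ⟨_, .activeAngel, .skip⟩
  | angel => cases hs; exact ⟨_, .angel, .skip⟩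
  | member => cases hs; exact ⟨_, .member, .skip⟩
  | enter h h' h'' => cases hs; exact ⟨_, .enter h h' h'', .skip⟩
  | exit h => cases hs; exact ⟨_, .exit h, .skip⟩
  | beginAtomic => cases hs; exact ⟨_, .beginAtomic, .skip⟩
  | endAtomic => cases hs; exact ⟨_, .endAtomic, .skip⟩

/-! ## Validity -/

/-- The value of a pointer expression is not a freed address. -/
def Comp.Live (τ : Comp S) (e : PExp S) : Prop := ∀ a, τ.mem.ptr e = some (.adr a) → a ∉ τ.freed

/-- Without reallocation, a variable is valid if and only if it does not hold a freed address; for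
selectors of addresses in use the same is true. -/
structure Comp.ValidIffLive (τ : Comp S) : Prop where
  live : ∀ e ∈ τ.valid, τ.Live e
  var : ∀ x, τ.Live (.var x) → .var x ∈ τ.valid
  sel : ∀ a, a ∉ τ.fresh → a ∉ τ.freed → τ.Live (.sel a) → .sel a ∈ τ.valid

namespace Comp.ValidIffLive

theorem ptrOf {τ : Comp S} (h : τ.ValidIffLive) {t : S.Thread} {p : S.PVar}
    (hp : τ.Live (ptrOf t p)) : SMR.ptrOf t p ∈ τ.valid := by
  obtain ⟨x, hx⟩ := ptrOf_eq_var t p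
  rw [hx] at hp ⊢
  exact h.var x hp

theorem nil : (Comp.nil : Comp S).ValidIffLive where
  live _ _ _ _ := id
  var x _ := ⟨x, rfl⟩
  -- Initially all addresses are fresh. Their selectors are invalid though they hold nothing freed,
  -- hence the freshness condition in `sel`.
  sel _ ha := absurd trivial ha

theorem free {τ : Comp S} (h : τ.ValidIffLive) (a : S.Adr) :
    (τ.snoc (.free a)).ValidIffLive where
  live := by
    rintro e ⟨he, hne⟩ b hb (hf | rfl)
    · exact h.live e he b hb hf
    · exact hne (.inl hb)
  var x hx := by
    refine ⟨h.var x fun b hb hf => hx b hb (.inl hf), ?_⟩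
    rintro (he | he)
    · exact hx a he (.inr rfl)
    · cases he
  sel b hb hf hx := by
    have hba : b ≠ a := fun hba => hf (.inr hba)
    refine ⟨h.sel b (fun hb' => hb ⟨hb', hba⟩) (fun hf' => hf (.inl hf'))
      fun b hb hf => hx b hb (.inl hf), ?_⟩
    rintro (he | he)
    · exact hx a he (.inr rfl)
    · cases he
      exact hba rfl

open Classical in
-- The common form of assignment, load and store: `e₀` takes over both value and validity of `e₁`,
-- so the characterization moves along with them.
theorem update {τ τ' : Comp S} (h : τ.ValidIffLive) {e₀ e₁ : PExp S}
    (hmem : ∀ e, τ'.mem.ptr e = if e = e₀ then τ.mem.ptr e₁ else τ.mem.ptr e)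
    (hfresh : τ'.fresh = τ.fresh) (hfreed : τ'.freed = τ.freed)
    (hvalid : τ'.valid = if e₁ ∈ τ.valid then τ.valid ∪ {e₀} else τ.valid \ {e₀})
    (he₁ : τ.Live e₁ → e₁ ∈ τ.valid) : τ'.ValidIffLive := by
  have hlive : ∀ e, τ'.Live e ↔ if e = e₀ then τ.Live e₁ else τ.Live e := by
    intro e
    simp only [Live, hmem, hfreed]
    split_ifs <;> rfl
  have hmv : ∀ e, e ∈ τ'.valid ↔ if e = e₀ then e₁ ∈ τ.valid else e ∈ τ.valid := by
    intro e
    rw [hvalid]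
    split_ifs <;> simp [*]
  refine ⟨fun e he => ?_, fun x hx => ?_, fun a ha hf hx => ?_⟩
  · rw [hmv] at he
    rw [hlive]
    split_ifs at he ⊢
    · exact h.live _ he
    · exact h.live _ he
  · rw [hlive] at hx
    rw [hmv]
    split_ifs at hx ⊢
    · exact he₁ hx
    · exact h.var x hx
  · rw [hlive] at hx
    rw [hmv]
    split_ifs at hx ⊢
    · exact he₁ hx
    · exact h.sel a (hfresh ▸ ha) (hfreed ▸ hf) hx

theorem of_eq {τ τ' : Comp S} (h : τ.ValidIffLive) (hmem : ∀ e, τ'.mem.ptr e = τ.mem.ptr e)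
    (hfresh : τ'.fresh = τ.fresh) (hfreed : τ'.freed = τ.freed) (hvalid : τ'.valid = τ.valid) :
    τ'.ValidIffLive := by
  have hlive : ∀ e, τ'.Live e ↔ τ.Live e := fun e => by simp only [Live, hmem, hfreed]
  refine ⟨fun e he => ?_, fun x hx => ?_, fun a ha hf hx => ?_⟩
  · exact (hlive e).2 (h.live e (hvalid ▸ he))
  · exact hvalid ▸ h.var x ((hlive _).1 hx)
  · exact hvalid ▸ h.sel a (hfresh ▸ ha) (hfreed ▸ hf) ((hlive _).1 hx)

/-- Commands that do not access memory through freed addresses preserve the characterization. -/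
theorem run {X : Set S.Adr} {τ : Comp S} {t : S.Thread} {c : Com S} {up : List (Upd S)}
    (h : τ.ValidIffLive) (hwf : τ.WF) (hen : Enabled X ∅ τ (.run t c up))
    (hload : ∀ p q, c = .load p q → τ.Live (SMR.ptrOf t q)) :
    (τ.snoc (.run t c up)).ValidIffLive := by
  classical
  cases hen
  case assign p q v hv =>
    exact h.update (e₀ := SMR.ptrOf t p) (e₁ := SMR.ptrOf t q)
      (fun e => by rw [Comp.mem_ptr_run_ptr, hv]) rfl rfl rfl h.ptrOf
  case load p q a v hv ha =>
    refine h.update (e₀ := SMR.ptrOf t p) (e₁ := .sel a)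
      (fun e => by rw [Comp.mem_ptr_run_ptr, hv]) rfl rfl (by simp only [Comp.valid, ha]) ?_
    -- The selector of a freed address may be invalid and yet hold a live value; loading from it
    -- would break the equivalence.
    exact h.sel a (hwf.ptr_notMem_fresh _ a ha) (hload p q rfl a ha)
  case store p q a v ha hv =>
    refine h.update (e₀ := .sel a) (e₁ := SMR.ptrOf t q)
      (fun e => by rw [Comp.mem_ptr_run_ptr, hv]) rfl rfl (by simp only [Comp.valid, ha]) ?_
    exact h.ptrOf
  case malloc p a d ha =>
    have ha : a ∈ τ.fresh := by simpa using ha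
    have haf := Comp.notMem_freed_of_mem_fresh ha
    have hfreed := τ.freed_malloc t p a d
    rw [Set.sdiff_singleton_eq_self haf] at hfreed
    have hfresh := τ.fresh_malloc t p a d
    set τ' := τ.snoc (.run t (.malloc p)
      [.ptr (SMR.ptrOf t p) (.adr a), .ptr (.sel a) .seg, .dat (.sel a) d]) with hτ'
    have hmem : ∀ e, τ'.mem.ptr e = if e = .sel a then some .seg else
        if e = SMR.ptrOf t p then some (.adr a) else τ.mem.ptr e := fun e => Comp.mem_ptr_malloc ..
    have hmv : ∀ e, e ∈ τ'.valid ↔ e ∈ τ.valid ∨ e = SMR.ptrOf t p ∨ e = .sel a := by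
      intro e
      simp [τ', Comp.valid, or_assoc, or_left_comm, or_comm]
    have hlive : ∀ e, e ≠ .sel a → e ≠ SMR.ptrOf t p → (τ'.Live e ↔ τ.Live e) := by
      intro e h₁ h₂
      simp [Live, hmem, hfreed, h₁, h₂]
    refine ⟨fun e he => ?_, fun x hx => ?_, fun b hb hf hx => ?_⟩
    · by_cases h₁ : e = .sel a
      · simp [Live, hmem, h₁]
      by_cases h₂ : e = SMR.ptrOf t p
      · simp [Live, hmem, hfreed, h₂, haf]
      · rw [hlive e h₁ h₂]
        exact h.live e (by simpa [hmv, h₁, h₂] using he)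
    · rw [hmv]
      by_cases h₂ : .var x = SMR.ptrOf t p
      · exact .inr (.inl h₂)
      · exact .inl (h.var x ((hlive _ (by simp) h₂).1 hx))
    · rw [hmv]
      by_cases h₁ : b = a
      · exact .inr (.inr (by rw [h₁]))
      · refine .inl (h.sel b ?_ (hfreed ▸ hf) ((hlive _ (by simpa using h₁) (by simp)).1 hx))
        exact fun hb' => hb (hfresh ▸ ⟨hb', h₁⟩)
  case assumeEq p q hpq =>
    refine h.of_eq (fun _ => rfl) rfl rfl ?_
    simp only [Comp.valid]
    split_ifs with hv
    -- The assumption validates nothing new: equal values are equally live, so if one variable is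
    -- valid, both already are.
    · refine Set.union_eq_self_of_subset_right ?_
      have hl : τ.Live (SMR.ptrOf t p) ↔ τ.Live (SMR.ptrOf t q) := by simp only [Live, hpq]
      have : τ.Live (SMR.ptrOf t p) := hv.elim (h.live _) fun hq => hl.2 (h.live _ hq)
      rintro e (rfl | rfl)
      · exact h.ptrOf this
      · exact h.ptrOf (hl.1 this)
    · rfl
  all_goals exact h.of_eq (fun _ => by simp) rfl rfl rfl

end Comp.ValidIffLive

/-! ## Soundness -/

/-- Control locations are described by derivable type environments. -/
structure ProgInv (B : Automaton S V) (Γ : Env B) (pc : S.Thread → Stmt S) (τ : Comp S)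
    (Γs : S.Thread → Env B) : Prop where
  valid : τ.ValidIffLive
  typed : ∀ t, Typed B (Γs t) (pc t) Γ
  inv : ∀ t, ThreadInv τ t (Γs t)
  stable : ∀ t ∉ τ.lockset, (Γs t).Stable

theorem ThreadInv.live {τ : Comp S} {t : S.Thread} {Γ : Env B} (h : ThreadInv τ t Γ) {p : S.PVar}
    (hp : IsValid (Γ (.inl p))) : τ.Live (ptrOf t p) :=
  fun a ha => (h.hasTy (.inl p) a ha).notMem_freed hp

section Soundness

variable {Γ : Env B} {pc : S.Thread → Stmt S} {τ : Comp S} {Γs : S.Thread → Env B}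

theorem ProgInv.start {P : Stmt S} (h : Typed B (Env.initial B) P Γ) :
    ProgInv B Γ (fun _ => P) .nil fun _ => Env.initial B where
  valid := .nil
  typed _ := h
  inv _ := ⟨fun _ _ _ => .empty, fun _ => id, fun _ _ h => absurd h id⟩
  stable _ _ := Env.stable_initial

open Classical in
theorem ProgInv.silent (h : ProgInv B Γ pc τ Γs) {t : S.Thread} {s : Stmt S}
    (hs : (pc t).Step none s) :
    ∃ Γ', ProgInv B Γ (Function.update pc t s) τ (Function.update Γs t Γ') := by
  obtain ⟨Γ', hΓ', hty⟩ := (h.typed t).step hs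
  refine ⟨Γ', h.valid, fun t' => ?_, fun t' => ?_, fun t' ht' => ?_⟩
  all_goals by_cases htt : t' = t
  · subst htt
    simpa using hty
  · simpa [Function.update_of_ne htt] using h.typed t'
  · subst htt
    simpa using (h.inv t').transformsEps hΓ'
  · simpa [Function.update_of_ne htt] using h.inv t'
  · subst htt
    simpa using (h.stable t' ht').transformsEps hΓ'
  · simpa [Function.update_of_ne htt] using h.stable t' ht'

theorem Comp.eq_endAtomic_of_lockset {t : S.Thread} {c : Com S} {up : List (Upd S)}
    (ht : t ∈ τ.lockset) (ht' : t ∉ (τ.snoc (.run t c up)).lockset) : c = .endAtomic := by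
  cases c
  case endAtomic => rfl
  case beginAtomic => exact absurd (.inl ht) ht'
  all_goals exact absurd ht ht'

open Classical in
-- The moving thread follows its derivation; all others are outside atomic blocks, so their
-- environments are stable and interference applies.
theorem ProgInv.run {X : Set S.Adr} (h : ProgInv B Γ pc τ Γs) {t : S.Thread} {c : Com S}
    {s : Stmt S} {up : List (Upd S)} (hs : (pc t).Step (some c) s) (hwf : τ.WF)
    (hen : Enabled X ∅ τ (.run t c up)) (hspec : τ.history ∈ (smrAut B).spec)
    (hspec' : (τ.snoc (.run t c up)).history ∈ (smrAut B).spec)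
    (hinv : (τ.snoc (.run t c up)).InvHolds) (hother : ∀ t' ≠ t, t' ∉ τ.lockset)
    (hlock : t ∈ τ.lockset ∨ t ∈ (τ.snoc (.run t c up)).lockset) :
    ∃ Γ', ProgInv B Γ (Function.update pc t s) (τ.snoc (.run t c up))
      (Function.update Γs t Γ') := by
  obtain ⟨Γ', hΓ', hty⟩ := (h.typed t).step hs
  refine ⟨Γ', h.valid.run hwf hen ?_, fun t' => ?_, fun t' => ?_, fun t' ht' => ?_⟩
  · rintro p q rfl
    exact (h.inv t).live hΓ'.isValid_load
  all_goals by_cases htt : t' = t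
  · subst htt
    simpa using hty
  · simpa [Function.update_of_ne htt] using h.typed t'
  · subst htt
    simpa using hΓ'.threadInv_run (h.inv t') hwf hen hspec hinv
  · rw [Function.update_of_ne htt]
    exact (h.inv t').interference_run (h.stable t' (hother t' htt)) (Ne.symm htt) hwf hen hspec'
  · subst htt
    -- Stability is demanded of the moving thread only if it is outside afterwards; then it has just
    -- left its atomic block.
    obtain rfl := Comp.eq_endAtomic_of_lockset (hlock.resolve_right ht') ht'
    simpa using hΓ'.stable_endAtomic
  · simpa [Function.update_of_ne htt] using h.stable t' (hother t' htt)

theorem ProgInv.free (hO : (smrAut B).Complete) (h : ProgInv B Γ pc τ Γs) {a : S.Adr}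
    (hl : τ.lockset = ∅) (hspec : (τ.snoc (.free a)).history ∈ (smrAut B).spec) :
    ProgInv B Γ pc (τ.snoc (.free a)) Γs where
  valid := h.valid.free a
  typed := h.typed
  inv t := (h.inv t).free hO (h.stable t (by simp [hl])) hspec
  stable := h.stable

/-- The induction is on `Control` and not on `Liberal`, because silent steps change locations
without extending the computation. `Liberal` is inverted only to learn that the last action was
enabled. -/
theorem Control.exists_progInv (hO : (smrAut B).Complete) (hA : (smrAut B).AcceptsByFree)
    {P : Stmt S} {X : Set S.Adr} (hinv : ∀ τ ∈ sem P ∅ ∅, τ.InvHolds)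
    (hty : Typed B (Env.initial B) P Γ) (hc : Control P pc τ) (hl : Liberal P X ∅ τ)
    (hs : τ.history ∈ (smrAut B).spec) : ∃ Γs, ProgInv B Γ pc τ Γs := by
  induction hc with
  | start => exact ⟨_, .start hty⟩
  | insideSilent _ hst _ ih | outsideSilent _ hst _ ih =>
    obtain ⟨Γs, h⟩ := ih hl hs
    obtain ⟨Γ', h⟩ := h.silent hst
    exact ⟨_, h⟩
  | @insideCom pc τ t c s up _ hst hlock ih =>
    have hI := hl.invHolds hO hA t hs hinv
    obtain _ | ⟨hl, -, hen⟩ := hl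
    have hs' := mem_spec_of_snoc hO hA hs
    obtain ⟨Γs, h⟩ := ih hl hs'
    obtain ⟨Γ', h⟩ := h.run hst hl.wf hen hs' hs hI (by simp [hlock]) (.inl (by simp [hlock]))
    exact ⟨_, h⟩
  | @acquire pc τ t c s up _ hst hlock hlock' ih =>
    have hI := hl.invHolds hO hA t hs hinv
    obtain _ | ⟨hl, -, hen⟩ := hl
    have hs' := mem_spec_of_snoc hO hA hs
    obtain ⟨Γs, h⟩ := ih hl hs'
    obtain ⟨Γ', h⟩ := h.run hst hl.wf hen hs' hs hI (by simp [hlock]) (.inr (by simp [hlock']))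
    exact ⟨_, h⟩
  | free a _ hlock ih =>
    obtain _ | ⟨hl, -, -⟩ := hl
    obtain ⟨Γs, h⟩ := ih hl (mem_spec_of_snoc hO hA hs)
    exact ⟨Γs, h.free hO hlock hs⟩

end Soundness

end SMR

/-- Soundness of the type system: if the invariant annotations hold in every computation of the
garbage-collected semantics, then derivable judgements are semantically sound. -/
theorem mainTheorem1 (S : SMR.Sig) (V : SMR.AutVars) (B : SMR.Automaton S V)
    (hcomplete : (SMR.smrAut B).Complete) (haccept : (SMR.smrAut B).AcceptsByFree)
    (P : SMR.Stmt S) (Γ : SMR.Env B)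
    (hinv : ∀ τ ∈ SMR.sem P ∅ ∅, τ.InvHolds)
    (hder : SMR.Typed B (SMR.Env.initial B) P Γ) :
    SMR.SemSound B P Γ := by
  rintro τ ⟨hl, hs⟩ t ⟨pc, hpc, hskip⟩
  obtain ⟨Γs, h⟩ := hpc.exists_progInv hcomplete haccept hinv hder hl hs
  have ht := h.typed t
  rw [hskip] at ht
  -- At `skip`, only consequence steps separate the thread's environment from `Γ`.
  have hI := (h.inv t).transformsEps ht.skip_inv
  refine ⟨fun x a ha φ hφt hφa => ?_, fun p hp => h.valid.ptrOf (hI.live hp)⟩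
  have hlocs := (hI.hasTy x a ha).locs φ hφt hφa
  -- The invariant only confines runs; that some run exists is due to completeness.
  obtain ⟨l, hr⟩ := hcomplete.exists_run φ (SMR.smrAut B).initial τ.history
  exact ⟨⟨l, hlocs l hr, hr⟩, hlocs⟩
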